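/- Let $k$ be a field, with $\otimes=\otimes_k$. A quasi-Hopf algebra over $k$ is an associative unital $k$-algebra $H$ with unital algebra homomorphisms $\Delta:H\to H\otimes H$ and $\varepsilon:H\to k$, an invertible element $\Phi=X^1\otimes X^2\otimes X^3\in H\otimes H\otimes H$ with inverse $\Phi^{-1}=x^1\otimes x^2\otimes x^3=y^1\otimes y^2\otimes y^3$ (summations understood), an anti-automorphism $S$ of the algebra $H$, and elements $\alpha,\beta\in H$, such that, writing $\Delta(h)=h_1\otimes h_2$, for all $h\in H$: $$(\mathrm{id}\otimes\Delta)(\Delta(h))=\Phi\,(\Delta\otimes\mathrm{id})(\Delta(h))\,\Phi^{-1},\qquad (\mathrm{id}\otimes\varepsilon)(\Delta(h))=h\otimes 1,\qquad (\varepsilon\otimes\mathrm{id})(\Delta(h))=1\otimes h,$$ $$(1\otimes\Phi)(\mathrm{id}\otimes\Delta\otimes\mathrm{id})(\Phi)(\Phi\otimes 1)=(\mathrm{id}\otimes\mathrm{id}\otimes\Delta)(\Phi)(\Delta\otimes\mathrm{id}\otimes\mathrm{id})(\Phi),$$ $$(\varepsilon\otimes\mathrm{id}\otimes\mathrm{id})(\Phi)=(\mathrm{id}\otimes\varepsilon\otimes\mathrm{id})(\Phi)=(\mathrm{id}\otimes\mathrm{id}\otimes\varepsilon)(\Phi)=1\otimes1\otimes1,$$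 $$S(h_1)\alpha h_2=\varepsilon(h)\alpha,\quad h_1\beta S(h_2)=\varepsilon(h)\beta,\quad X^1\beta S(X^2)\alpha X^3=1,\quad S(x^1)\alpha x^2\beta S(x^3)=1.$$ Let $H^*=\mathrm{Hom}_k(H,k)$, with the convolution product $(\varphi\psi)(h)=\varphi(h_1)\psi(h_2)$ and the regular actions $(h\rightharpoonup\varphi)(h')=\varphi(h'h)$ and $(\varphi\leftharpoonup h)(h')=\varphi(hh')$. Theorem. Let $H$ be a finite-dimensional quasi-Hopf algebra over $k$. The (Hausser–Nill) two-sided crossed product $H \mathbin{>\!\triangleleft} H^* \mathbin{\triangleright\!<} H$, that is, the vector space $H\otimes H^*\otimes H$ with the bilinear multiplication determined by $$(h\otimes\varphi\otimes l)(h'\otimes\varphi'\otimes l')=hh'_1x^1\otimes(y^1\rightharpoonup\varphi\leftharpoonup h'_2x^2)(y^2l_1\rightharpoonup\varphi'\leftharpoonup x^3)\otimes y^3l_2l',$$ is an associative algebra with unit $1\otimes\varepsilon\otimes1$, and it is isomorphic, as a unital associative $k$-algebra, to $\mathrm{End}_k(H)\otimes H$, where $\mathrm{End}_k(H)$ is the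 algebra of $k$-linear endomorphisms of $H$ under composition. -/

import Mathlib

open scoped TensorProduct

/-- A quasi-bialgebra structure `(Δ, ε, Φ)` on the associative unital `k`-algebra `H`.
Iterated tensor powers of `H` are bracketed to the right, `H ⊗ (H ⊗ H)` and
`H ⊗ (H ⊗ (H ⊗ H))`; the canonical (re-bracketing) algebra isomorphisms are written out. -/
structure QuasiBialgebra (k H : Type*) [Field k] [Ring H] [Algebra k H] where
  /-- the coproduct `Δ` -/
  comul : H →ₐ[k] H ⊗[k] H
  /-- the counit `ε` -/
  counit : H →ₐ[k] k
  /-- the reassociator `Φ`, with inverse `Φ⁻¹` -/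
  reassoc : (H ⊗[k] (H ⊗[k] H))ˣ
  /-- `(id ⊗ Δ)(Δ(h)) = Φ (Δ ⊗ id)(Δ(h)) Φ⁻¹` -/
  quasi_coassoc : ∀ h : H,
    Algebra.TensorProduct.map (AlgHom.id k H) comul (comul h) =
      (reassoc : H ⊗[k] (H ⊗[k] H)) *
        Algebra.TensorProduct.assoc k k k H H H
          (Algebra.TensorProduct.map comul (AlgHom.id k H) (comul h)) *
        ((reassoc⁻¹ : (H ⊗[k] (H ⊗[k] H))ˣ) : H ⊗[k] (H ⊗[k] H))
  /-- `(id ⊗ ε)(Δ(h)) = h ⊗ 1` -/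
  id_counit_comul : ∀ h : H,
    Algebra.TensorProduct.map (AlgHom.id k H) counit (comul h) = h ⊗ₜ[k] (1 : k)
  /-- `(ε ⊗ id)(Δ(h)) = 1 ⊗ h` -/
  counit_id_comul : ∀ h : H,
    Algebra.TensorProduct.map counit (AlgHom.id k H) (comul h) = (1 : k) ⊗ₜ[k] h
  /-- `(1 ⊗ Φ) (id ⊗ Δ ⊗ id)(Φ) (Φ ⊗ 1) = (id ⊗ id ⊗ Δ)(Φ) (Δ ⊗ id ⊗ id)(Φ)` -/
  pentagon :
    ((1 : H) ⊗ₜ[k] (reassoc : H ⊗[k] (H ⊗[k] H))) *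
        Algebra.TensorProduct.map (AlgHom.id k H)
          ((Algebra.TensorProduct.assoc k k k H H H).toAlgHom.comp
            (Algebra.TensorProduct.map comul (AlgHom.id k H)))
          (reassoc : H ⊗[k] (H ⊗[k] H)) *
        Algebra.TensorProduct.map (AlgHom.id k H)
          (Algebra.TensorProduct.assoc k k k H H H).toAlgHom
          (Algebra.TensorProduct.assoc k k k H (H ⊗[k] H) H
            ((reassoc : H ⊗[k] (H ⊗[k] H)) ⊗ₜ[k] (1 : H))) =
      Algebra.TensorProduct.map (AlgHom.id k H)
          (Algebra.TensorProduct.map (AlgHom.id k H) comul)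
          (reassoc : H ⊗[k] (H ⊗[k] H)) *
        Algebra.TensorProduct.assoc k k k H H (H ⊗[k] H)
          (Algebra.TensorProduct.map comul (AlgHom.id k (H ⊗[k] H))
            (reassoc : H ⊗[k] (H ⊗[k] H)))
  /-- `(ε ⊗ id ⊗ id)(Φ) = 1 ⊗ 1 ⊗ 1` -/
  counit_fst : Algebra.TensorProduct.map counit (AlgHom.id k (H ⊗[k] H))
    (reassoc : H ⊗[k] (H ⊗[k] H)) = 1
  /-- `(id ⊗ ε ⊗ id)(Φ) = 1 ⊗ 1 ⊗ 1` -/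
  counit_snd : Algebra.TensorProduct.map (AlgHom.id k H)
    (Algebra.TensorProduct.map counit (AlgHom.id k H)) (reassoc : H ⊗[k] (H ⊗[k] H)) = 1
  /-- `(id ⊗ id ⊗ ε)(Φ) = 1 ⊗ 1 ⊗ 1` -/
  counit_trd : Algebra.TensorProduct.map (AlgHom.id k H)
    (Algebra.TensorProduct.map (AlgHom.id k H) counit) (reassoc : H ⊗[k] (H ⊗[k] H)) = 1

/-- The linear map `h ↦ S(h)` underlying an algebra anti-automorphism `S` of `H`. -/
def antiLin {k H : Type*} [Field k] [Ring H] [Algebra k H] (S : H ≃ₐ[k] Hᵐᵒᵖ) : H →ₗ[k] H :=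
  (MulOpposite.opLinearEquiv k : H ≃ₗ[k] Hᵐᵒᵖ).symm.toLinearMap ∘ₗ S.toLinearMap

/-- A quasi-Hopf algebra structure on `H`: a quasi-bialgebra structure with an anti-automorphism
`S` of the algebra `H` and elements `α, β` of `H`. -/
structure QuasiHopfAlgebra (k H : Type*) [Field k] [Ring H] [Algebra k H] extends
    QuasiBialgebra k H where
  /-- the antipode `S`, an algebra anti-automorphism of `H` -/
  antipode : H ≃ₐ[k] Hᵐᵒᵖ
  /-- the element `α` -/
  alpha : H
  /-- the element `β` -/
  beta : H
  /-- `S(h₁) α h₂ = ε(h) α` -/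
  antipode_alpha : ∀ h : H,
    LinearMap.mul' k H
      (TensorProduct.map (LinearMap.mulRight k alpha ∘ₗ antiLin antipode) LinearMap.id
        (comul h)) = counit h • alpha
  /-- `h₁ β S(h₂) = ε(h) β` -/
  beta_antipode : ∀ h : H,
    LinearMap.mul' k H
      (TensorProduct.map (LinearMap.mulRight k beta) (antiLin antipode)
        (comul h)) = counit h • beta
  /-- `X¹ β S(X²) α X³ = 1`, where `Φ = X¹ ⊗ X² ⊗ X³` -/
  reassoc_antipode :
    LinearMap.mul' k H
      (TensorProduct.map (LinearMap.mulRight k beta)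
        (LinearMap.mul' k H ∘ₗ
          TensorProduct.map (LinearMap.mulRight k alpha ∘ₗ antiLin antipode) LinearMap.id)
        (reassoc : H ⊗[k] (H ⊗[k] H))) = 1
  /-- `S(x¹) α x² β S(x³) = 1`, where `Φ⁻¹ = x¹ ⊗ x² ⊗ x³` -/
  reassoc_inv_antipode :
    LinearMap.mul' k H
      (TensorProduct.map (LinearMap.mulRight k alpha ∘ₗ antiLin antipode)
        (LinearMap.mul' k H ∘ₗ
          TensorProduct.map (LinearMap.mulRight k beta) (antiLin antipode))
        ((reassoc⁻¹ : (H ⊗[k] (H ⊗[k] H))ˣ) : H ⊗[k] (H ⊗[k] H))) = 1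

namespace QuasiBialgebra

section regular

variable (k H : Type*) [Field k] [Ring H] [Algebra k H]

/-- The left regular action of `H` on `H*`: `⟨h ⇀ φ, h'⟩ = φ(h' h)`. -/
def regL : H →ₗ[k] Module.Dual k H →ₗ[k] Module.Dual k H :=
  LinearMap.mk₂ k (fun h φ => φ ∘ₗ LinearMap.mulRight k h)
    (by intros; ext; simp [mul_add]) (by intros; ext; simp)
    (by intros; ext; simp) (by intros; ext; simp)

/-- The right regular action of `H` on `H*`: `⟨φ ↼ h, h'⟩ = φ(h h')`. -/
def regR : H →ₗ[k] Module.Dual k H →ₗ[k] Module.Dual k H :=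
  LinearMap.mk₂ k (fun h φ => φ ∘ₗ LinearMap.mulLeft k h)
    (by intros; ext; simp [add_mul]) (by intros; ext; simp)
    (by intros; ext; simp) (by intros; ext; simp)

@[simp] theorem regL_apply (h : H) (φ : Module.Dual k H) (h' : H) :
    regL k H h φ h' = φ (h' * h) := rfl

@[simp] theorem regR_apply (h : H) (φ : Module.Dual k H) (h' : H) :
    regR k H h φ h' = φ (h * h') := rfl

end regular

variable {k H : Type*} [Field k] [Ring H] [Algebra k H] (Q : QuasiBialgebra k H)

/-- The convolution on `H*`: `⟨φ ψ, h⟩ = φ(h₁) ψ(h₂)`. -/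
def conv : Module.Dual k H →ₗ[k] Module.Dual k H →ₗ[k] Module.Dual k H :=
  LinearMap.mk₂ k
    (fun φ ψ => LinearMap.mul' k k ∘ₗ TensorProduct.map φ ψ ∘ₗ Q.comul.toLinearMap)
    (by intros; ext; simp [TensorProduct.map_add_left])
    (by intros; ext; simp [TensorProduct.map_smul_left])
    (by intros; ext; simp [TensorProduct.map_add_right])
    (by intros; ext; simp [TensorProduct.map_smul_right])

theorem conv_apply (φ ψ : Module.Dual k H) (h : H) :
    Q.conv φ ψ h = LinearMap.mul' k k (TensorProduct.map φ ψ (Q.comul h)) := rfl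

/-- `(h, h') ↦ h h'₁ x¹ ⊗ h'₂ x² ⊗ x³`, where `Φ⁻¹ = x¹ ⊗ x² ⊗ x³`. -/
def leftLeg : H →ₗ[k] H →ₗ[k] H ⊗[k] (H ⊗[k] H) :=
  LinearMap.mk₂ k
    (fun h h' => (h ⊗ₜ[k] (1 : H ⊗[k] H)) *
      Algebra.TensorProduct.assoc k k k H H H (Q.comul h' ⊗ₜ[k] (1 : H)) *
      ((Q.reassoc⁻¹ : (H ⊗[k] (H ⊗[k] H))ˣ) : H ⊗[k] (H ⊗[k] H)))
    (by intros; simp [TensorProduct.add_tmul, add_mul])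
    (by intros; rw [← TensorProduct.smul_tmul', smul_mul_assoc, smul_mul_assoc])
    (by intros; simp [TensorProduct.add_tmul, add_mul, mul_add])
    (by intros; rw [map_smul, ← TensorProduct.smul_tmul', map_smul, mul_smul_comm,
      smul_mul_assoc])

/-- `(l, l') ↦ y¹ ⊗ y² l₁ ⊗ y³ l₂ l'`, where `Φ⁻¹ = y¹ ⊗ y² ⊗ y³`. -/
def rightLeg : H →ₗ[k] H →ₗ[k] H ⊗[k] (H ⊗[k] H) :=
  LinearMap.mk₂ k
    (fun l l' => ((Q.reassoc⁻¹ : (H ⊗[k] (H ⊗[k] H))ˣ) : H ⊗[k] (H ⊗[k] H)) *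
      ((1 : H) ⊗ₜ[k] Q.comul l) * ((1 : H) ⊗ₜ[k] ((1 : H) ⊗ₜ[k] l')))
    (by intros; simp [TensorProduct.tmul_add, add_mul, mul_add])
    (by intros; rw [map_smul, TensorProduct.tmul_smul, mul_smul_comm, smul_mul_assoc])
    (by intros; simp [TensorProduct.tmul_add, mul_add])
    (by intros; rw [TensorProduct.tmul_smul, TensorProduct.tmul_smul, mul_smul_comm])

/-- `(u² ⊗ u³) ⊗ ((φ ⊗ φ') ⊗ (w¹ ⊗ w²)) ↦ (w¹ ⇀ φ ↼ u²) (w² ⇀ φ' ↼ u³)`. -/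
def dualLeg : (H ⊗[k] H) ⊗[k] ((Module.Dual k H ⊗[k] Module.Dual k H) ⊗[k] (H ⊗[k] H)) →ₗ[k]
    Module.Dual k H :=
  TensorProduct.lift Q.conv ∘ₗ
    TensorProduct.lift (TensorProduct.map₂ (regL k H) (regL k H)).flip ∘ₗ
    TensorProduct.map (TensorProduct.lift (TensorProduct.map₂ (regR k H) (regR k H)))
      LinearMap.id ∘ₗ
    (TensorProduct.assoc k _ _ _).symm.toLinearMap

/-- `(u¹ ⊗ u² ⊗ u³) ⊗ ((φ ⊗ φ') ⊗ (w¹ ⊗ w² ⊗ w³)) ↦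
u¹ ⊗ (w¹ ⇀ φ ↼ u²) (w² ⇀ φ' ↼ u³) ⊗ w³`. -/
def assemble : (H ⊗[k] (H ⊗[k] H)) ⊗[k]
      ((Module.Dual k H ⊗[k] Module.Dual k H) ⊗[k] (H ⊗[k] (H ⊗[k] H))) →ₗ[k]
    H ⊗[k] (Module.Dual k H ⊗[k] H) :=
  TensorProduct.map LinearMap.id
    (TensorProduct.map Q.dualLeg LinearMap.id ∘ₗ
      (TensorProduct.assoc k _ _ _).symm.toLinearMap ∘ₗ
      TensorProduct.map LinearMap.id
        ((TensorProduct.assoc k _ _ _).symm.toLinearMap ∘ₗ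
          TensorProduct.map LinearMap.id (TensorProduct.assoc k H H H).symm.toLinearMap)) ∘ₗ
  (TensorProduct.assoc k _ _ _).toLinearMap

theorem assemble_tmul (u₁ u₂ u₃ w₁ w₂ w₃ : H) (φ ψ : Module.Dual k H) :
    Q.assemble ((u₁ ⊗ₜ[k] (u₂ ⊗ₜ[k] u₃)) ⊗ₜ[k]
        ((φ ⊗ₜ[k] ψ) ⊗ₜ[k] (w₁ ⊗ₜ[k] (w₂ ⊗ₜ[k] w₃)))) =
      u₁ ⊗ₜ[k] (Q.conv (regL k H w₁ (regR k H u₂ φ)) (regL k H w₂ (regR k H u₃ ψ)) ⊗ₜ[k] w₃) :=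
  rfl

/-- The multiplication of the two-sided crossed product `H >◁ H* ▷< H`, on `H ⊗ H* ⊗ H`:
`(h ⊗ φ ⊗ l)(h' ⊗ φ' ⊗ l') =
h h'₁ x¹ ⊗ (y¹ ⇀ φ ↼ h'₂ x²) (y² l₁ ⇀ φ' ↼ x³) ⊗ y³ l₂ l'`,
where `Φ⁻¹ = x¹ ⊗ x² ⊗ x³ = y¹ ⊗ y² ⊗ y³`. -/
def crossedMul : H ⊗[k] (Module.Dual k H ⊗[k] H) →ₗ[k] H ⊗[k] (Module.Dual k H ⊗[k] H) →ₗ[k]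
    H ⊗[k] (Module.Dual k H ⊗[k] H) :=
  (TensorProduct.map₂ Q.leftLeg
    (TensorProduct.map₂ (TensorProduct.mk k (Module.Dual k H) (Module.Dual k H))
      Q.rightLeg)).compr₂ Q.assemble

/-- The multiplication formula of the two-sided crossed product in terms of components
`Δ(h') = ∑ a ⊗ b`, `Δ(l) = ∑ c ⊗ d`, `Φ⁻¹ = ∑ x¹ ⊗ x² ⊗ x³`. -/
theorem crossedMul_tmul {ι κ τ : Type*} (s : Finset ι) (t : Finset κ) (r : Finset τ)
    (a b : ι → H) (c d : κ → H) (x₁ x₂ x₃ : τ → H) (h h' l l' : H) (φ φ' : Module.Dual k H)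
    (hh' : Q.comul h' = ∑ i ∈ s, a i ⊗ₜ[k] b i) (hl : Q.comul l = ∑ j ∈ t, c j ⊗ₜ[k] d j)
    (hx : ((Q.reassoc⁻¹ : (H ⊗[k] (H ⊗[k] H))ˣ) : H ⊗[k] (H ⊗[k] H)) =
      ∑ p ∈ r, x₁ p ⊗ₜ[k] (x₂ p ⊗ₜ[k] x₃ p)) :
    Q.crossedMul (h ⊗ₜ[k] (φ ⊗ₜ[k] l)) (h' ⊗ₜ[k] (φ' ⊗ₜ[k] l')) =
      ∑ i ∈ s, ∑ p ∈ r, ∑ q ∈ r, ∑ j ∈ t,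
        (h * a i * x₁ p) ⊗ₜ[k]
          (Q.conv (regL k H (x₁ q) (regR k H (b i * x₂ p) φ))
              (regL k H (x₂ q * c j) (regR k H (x₃ p) φ')) ⊗ₜ[k]
            (x₃ q * d j * l')) := by
  have hL : Q.leftLeg h h' = ∑ i ∈ s, ∑ p ∈ r,
      (h * a i * x₁ p) ⊗ₜ[k] ((b i * x₂ p) ⊗ₜ[k] x₃ p) := by
    simp [leftLeg, hh', hx, TensorProduct.sum_tmul, Finset.mul_sum, Finset.sum_mul,
      Algebra.TensorProduct.one_def]
    rw [Finset.sum_comm]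
  have hR : Q.rightLeg l l' = ∑ q ∈ r, ∑ j ∈ t,
      x₁ q ⊗ₜ[k] ((x₂ q * c j) ⊗ₜ[k] (x₃ q * d j * l')) := by
    simp [rightLeg, hl, hx, TensorProduct.tmul_sum, Finset.mul_sum, Finset.sum_mul]
  change Q.assemble (Q.leftLeg h h' ⊗ₜ[k] ((φ ⊗ₜ[k] φ') ⊗ₜ[k] Q.rightLeg l l')) = _
  rw [hL, hR]
  simp only [TensorProduct.sum_tmul]
  simp only [TensorProduct.tmul_sum]
  simp only [map_sum, assemble_tmul]

/-- The unit `1 ⊗ ε ⊗ 1` of the two-sided crossed product. -/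
def crossedOne : H ⊗[k] (Module.Dual k H ⊗[k] H) :=
  (1 : H) ⊗ₜ[k] (Q.counit.toLinearMap ⊗ₜ[k] (1 : H))

end QuasiBialgebra

/-! The crossed product is represented faithfully on `H ⊗ H`, and its image is identified there. The
element `h` acts as left multiplication by `Δ(h)`, `l` as right multiplication by `1 ⊗ S⁻¹(l)`, and
a functional `φ` as `m ↦ (id ⊗ id ⊗ φ)(ρ(m)(1 ⊗ g))`, where `ρ(m) = Φ⁻¹ (id ⊗ Δ)(m)` and `g` is
`twist`. For an ordinary Hopf algebra `g = 1`.

In general `g` is needed to make these operators obey the straightening relations hidden in the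
crossed multiplication. It must intertwine, `Δ(S⁻¹(h₂)) g (1 ⊗ h₁) = g (S⁻¹(h) ⊗ 1)`
(`coactTwo_twist`), be normalised, `(id ⊗ ε)(g) = 1` (`counitRight_twist`), and satisfy a cocycle
identity (`comulLeft_twist_mul_append`). Granted these, `h ⊗ φ ⊗ l ↦ h ∘ φ ∘ l` is multiplicative
and unital (`act_crossedMul`, `act_crossedOne`).

All these operators commute with right multiplication by `r ⊗ 1`, and so do the operators `v ⊗ x ↦ a
v ⊗ f(x)`, which form a copy of `End(H) ⊗ H` (`endMap`). The substantial point is that the latter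
all lie in the image of `act` (`range_endMap_le`): `g` is first removed from the operators of `H*`
(`one_mem_admissible`), and then `id ⊗ f` is rebuilt from `ρ` by a zigzag with `α` and `β`
(`lTensor_mem_range_act`). Both algebras have dimension `(dim H)³`, so the two images agree and
`act` is injective. Associativity and the unit laws are pulled back along `act` from the
endomorphism algebra, and the isomorphism is `act` followed by the inverse of `endMap`. -/

namespace TensorProduct

variable {k H : Type*} [Field k] [Ring H] [Algebra k H]

theorem induction_three {p : H ⊗[k] (H ⊗[k] H) → Prop} (w : H ⊗[k] (H ⊗[k] H)) (zero : p 0)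
    (add : ∀ x y, p x → p y → p (x + y)) (tmul : ∀ a b c, p (a ⊗ₜ (b ⊗ₜ c))) : p w := by
  induction w with
  | zero => exact zero
  | add x y hx hy => exact add x y hx hy
  | tmul a w =>
    induction w with
    | zero => simpa using zero
    | add x y hx hy => rw [tmul_add]; exact add _ _ hx hy
    | tmul b c => exact tmul a b c

theorem induction_four {p : H ⊗[k] (H ⊗[k] (H ⊗[k] H)) → Prop}
    (w : H ⊗[k] (H ⊗[k] (H ⊗[k] H))) (zero : p 0)
    (add : ∀ x y, p x → p y → p (x + y))
    (tmul : ∀ a b c d, p (a ⊗ₜ (b ⊗ₜ (c ⊗ₜ d)))) : p w := by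
  induction w with
  | zero => exact zero
  | add x y hx hy => exact add x y hx hy
  | tmul a w =>
    induction w using induction_three with
    | zero => simpa using zero
    | add x y hx hy => rw [tmul_add]; exact add _ _ hx hy
    | tmul b c d => exact tmul a b c d

end TensorProduct

/-! ### Coproducts on single tensor legs and rearranged forms of the pentagon. -/

namespace QuasiBialgebra

set_option maxSynthPendingDepth 6

open TensorProduct

variable {k H : Type*} [Field k] [Ring H] [Algebra k H] (Q : QuasiBialgebra k H)

/-- The inverse reassociator `Φ⁻¹`. -/
def reassocInv : H ⊗[k] (H ⊗[k] H) := ((Q.reassoc⁻¹ : (H ⊗[k] (H ⊗[k] H))ˣ) : H ⊗[k] (H ⊗[k] H))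

theorem reassoc_mul_inv : (Q.reassoc : H ⊗[k] (H ⊗[k] H)) * Q.reassocInv = 1 :=
  Q.reassoc.mul_inv

theorem reassoc_inv_mul : Q.reassocInv * (Q.reassoc : H ⊗[k] (H ⊗[k] H)) = 1 :=
  Q.reassoc.inv_mul

/-- `Δ ⊗ id` on `H ⊗ H`. -/
def comulLeft : H ⊗[k] H →ₐ[k] H ⊗[k] (H ⊗[k] H) :=
  (Algebra.TensorProduct.assoc k k k H H H).toAlgHom.comp
    (Algebra.TensorProduct.map Q.comul (AlgHom.id k H))

/-- `id ⊗ Δ` on `H ⊗ H`. -/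
def comulRight : H ⊗[k] H →ₐ[k] H ⊗[k] (H ⊗[k] H) :=
  Algebra.TensorProduct.map (AlgHom.id k H) Q.comul

/-- `Δ ⊗ id ⊗ id`. -/
def comulFst : H ⊗[k] (H ⊗[k] H) →ₐ[k] H ⊗[k] (H ⊗[k] (H ⊗[k] H)) :=
  (Algebra.TensorProduct.assoc k k k H H (H ⊗[k] H)).toAlgHom.comp
    (Algebra.TensorProduct.map Q.comul (AlgHom.id k (H ⊗[k] H)))

/-- `id ⊗ Δ ⊗ id`. -/
def comulSnd : H ⊗[k] (H ⊗[k] H) →ₐ[k] H ⊗[k] (H ⊗[k] (H ⊗[k] H)) :=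
  Algebra.TensorProduct.map (AlgHom.id k H) Q.comulLeft

/-- `id ⊗ id ⊗ Δ`. -/
def comulTrd : H ⊗[k] (H ⊗[k] H) →ₐ[k] H ⊗[k] (H ⊗[k] (H ⊗[k] H)) :=
  Algebra.TensorProduct.map (AlgHom.id k H) Q.comulRight

variable (k H) in
/-- `a ⊗ b ↦ a ⊗ b ⊗ 1`. -/
def appendTwo : H ⊗[k] H →ₐ[k] H ⊗[k] (H ⊗[k] H) :=
  Algebra.TensorProduct.map (AlgHom.id k H) Algebra.TensorProduct.includeLeft

variable (k H) in
/-- `a ⊗ b ⊗ c ↦ a ⊗ b ⊗ c ⊗ 1`. -/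
def appendThree : H ⊗[k] (H ⊗[k] H) →ₐ[k] H ⊗[k] (H ⊗[k] (H ⊗[k] H)) :=
  Algebra.TensorProduct.map (AlgHom.id k H) (appendTwo k H)

@[simp] theorem comulLeft_tmul (a b : H) :
    Q.comulLeft (a ⊗ₜ b) = TensorProduct.assoc k H H H (Q.comul a ⊗ₜ b) := rfl

@[simp] theorem comulRight_tmul (a b : H) : Q.comulRight (a ⊗ₜ b) = a ⊗ₜ Q.comul b := rfl

@[simp] theorem comulFst_tmul (a : H) (w : H ⊗[k] H) :
    Q.comulFst (a ⊗ₜ w) = TensorProduct.assoc k H H (H ⊗[k] H) (Q.comul a ⊗ₜ w) := rfl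

@[simp] theorem comulSnd_tmul (a : H) (w : H ⊗[k] H) :
    Q.comulSnd (a ⊗ₜ w) = a ⊗ₜ Q.comulLeft w := rfl

@[simp] theorem comulTrd_tmul (a : H) (w : H ⊗[k] H) :
    Q.comulTrd (a ⊗ₜ w) = a ⊗ₜ Q.comulRight w := rfl

@[simp] theorem appendTwo_tmul (a b : H) : appendTwo k H (a ⊗ₜ b) = a ⊗ₜ (b ⊗ₜ 1) := rfl

@[simp] theorem appendThree_tmul (a : H) (w : H ⊗[k] H) :
    appendThree k H (a ⊗ₜ w) = a ⊗ₜ appendTwo k H w := rfl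

theorem comulRight_comul_mul_reassoc (h : H) :
    Q.comulRight (Q.comul h) * Q.reassoc = Q.reassoc * Q.comulLeft (Q.comul h) := by
  have := Q.quasi_coassoc h
  change Q.comulRight (Q.comul h) = Q.reassoc * Q.comulLeft (Q.comul h) * _ at this
  rw [this, mul_assoc, Units.inv_mul, mul_one]

theorem reassocInv_mul_comulRight_comul (h : H) :
    Q.reassocInv * Q.comulRight (Q.comul h) = Q.comulLeft (Q.comul h) * Q.reassocInv := by
  have := Q.quasi_coassoc h
  change Q.comulRight (Q.comul h) = Q.reassoc * Q.comulLeft (Q.comul h) * _ at this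
  rw [this, mul_assoc, ← mul_assoc, reassoc_inv_mul, one_mul]; rfl

theorem pentagon_eq :
    ((1 : H) ⊗ₜ[k] (Q.reassoc : H ⊗[k] (H ⊗[k] H))) * Q.comulSnd Q.reassoc *
      appendThree k H Q.reassoc = Q.comulTrd Q.reassoc * Q.comulFst Q.reassoc := by
  have h : ∀ w : H ⊗[k] (H ⊗[k] H), appendThree k H w =
      Algebra.TensorProduct.map (AlgHom.id k H)
          (Algebra.TensorProduct.assoc k k k H H H).toAlgHom
          (Algebra.TensorProduct.assoc k k k H (H ⊗[k] H) H (w ⊗ₜ[k] (1 : H))) := by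
    intro w
    induction w using induction_three with
    | zero => simp
    | add x y hx hy => simp only [map_add, add_tmul, hx, hy]
    | tmul a b c => simp
  rw [h]
  exact Q.pentagon

section units

/-- `Φ` with `1` prepended, as a unit. -/
def oneReassoc : (H ⊗[k] (H ⊗[k] (H ⊗[k] H)))ˣ :=
  Units.map (Algebra.TensorProduct.includeRight :
    H ⊗[k] (H ⊗[k] H) →ₐ[k] H ⊗[k] (H ⊗[k] (H ⊗[k] H))).toMonoidHom Q.reassoc

theorem pentagon_units :
    Q.oneReassoc * Units.map Q.comulSnd.toMonoidHom Q.reassoc *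
      Units.map (appendThree k H).toMonoidHom Q.reassoc =
    Units.map Q.comulTrd.toMonoidHom Q.reassoc * Units.map Q.comulFst.toMonoidHom Q.reassoc :=
  Units.ext Q.pentagon_eq

/-- The pentagon is solved so that the factors in which `Δ` meets an evaluation or a coevaluation
stand at the ends, where the antipode axioms turn `Δ` into `ε`. -/
theorem comulTrd_inv_mul :
    Q.comulTrd Q.reassocInv * ((1 : H) ⊗ₜ[k] (Q.reassoc : H ⊗[k] (H ⊗[k] H))) =
      Q.comulFst Q.reassoc * appendThree k H Q.reassocInv * Q.comulSnd Q.reassocInv := by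
  have h := Q.pentagon_units
  have : (Units.map Q.comulTrd.toMonoidHom Q.reassoc)⁻¹ * Q.oneReassoc =
    Units.map Q.comulFst.toMonoidHom Q.reassoc *
      (Units.map (appendThree k H).toMonoidHom Q.reassoc)⁻¹ *
      (Units.map Q.comulSnd.toMonoidHom Q.reassoc)⁻¹ := by
    rw [eq_mul_inv_iff_mul_eq, eq_mul_inv_iff_mul_eq, mul_assoc, mul_assoc,
      inv_mul_eq_iff_eq_mul, ← mul_assoc]
    exact h
  exact congrArg Units.val this

theorem append_comulSnd_inv :
    appendThree k H Q.reassocInv * Q.comulSnd Q.reassocInv * ((1 : H) ⊗ₜ[k] Q.reassocInv) =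
      Q.comulFst Q.reassocInv * Q.comulTrd Q.reassocInv := by
  have h := congrArg (fun u => u⁻¹) Q.pentagon_units
  simp only [mul_inv_rev] at h
  have := congrArg Units.val h
  rw [← mul_assoc] at this
  exact this

theorem comulFst_mul_append_inv :
    Q.comulFst Q.reassoc * appendThree k H Q.reassocInv =
      Q.comulTrd Q.reassocInv * ((1 : H) ⊗ₜ[k] (Q.reassoc : H ⊗[k] (H ⊗[k] H))) *
        Q.comulSnd Q.reassoc := by
  rw [comulTrd_inv_mul, mul_assoc _ (Q.comulSnd _) (Q.comulSnd _), ← map_mul, reassoc_inv_mul,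
    map_one, mul_one]

end units

/-! ### Dropping factors by counitality. -/

section counit

variable {N : Type*} [AddCommGroup N] [Module k N]

theorem reassocInv_map {B : Type*} [Ring B] [Algebra k B] (f : H ⊗[k] (H ⊗[k] H) →ₐ[k] B)
    (h : f Q.reassoc = 1) : f Q.reassocInv = 1 := by
  rw [← one_mul (f Q.reassocInv)]
  nth_rw 1 [← h]
  rw [← map_mul, reassoc_mul_inv, map_one]

theorem counit_snd_inv : Algebra.TensorProduct.map (AlgHom.id k H)
    (Algebra.TensorProduct.map Q.counit (AlgHom.id k H)) Q.reassocInv = 1 :=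
  Q.reassocInv_map _ Q.counit_snd

theorem counit_trd_inv : Algebra.TensorProduct.map (AlgHom.id k H)
    (Algebra.TensorProduct.map (AlgHom.id k H) Q.counit) Q.reassocInv = 1 :=
  Q.reassocInv_map _ Q.counit_trd

/-- A linear map that sees one leg only through `ε` cannot distinguish a counital element from `1`.
With its two companions this is the tool that erases copies of `Φ` and `Φ⁻¹` from long products. -/
theorem eq_of_counit_fst {w : H ⊗[k] (H ⊗[k] H)}
    (hw : Algebra.TensorProduct.map Q.counit (AlgHom.id k (H ⊗[k] H)) w = 1)
    (G : H ⊗[k] (H ⊗[k] H) →ₗ[k] N)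
    (hG : ∀ a b c, G (a ⊗ₜ (b ⊗ₜ c)) = Q.counit a • G (1 ⊗ₜ (b ⊗ₜ c))) : G w = G 1 := by
  have h : ∀ w, G w = G (Algebra.TensorProduct.map (Algebra.ofId k H)
      (AlgHom.id k (H ⊗[k] H))
      (Algebra.TensorProduct.map Q.counit (AlgHom.id k (H ⊗[k] H)) w)) := by
    intro w
    induction w using induction_three with
    | zero => simp
    | add x y hx hy => simp only [map_add, hx, hy]
    | tmul a b c =>
      rw [hG]
      simp [Algebra.ofId_apply, Algebra.algebraMap_eq_smul_one, ← smul_tmul']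
  rw [h, hw, map_one]

theorem eq_of_counit_snd {w : H ⊗[k] (H ⊗[k] H)}
    (hw : Algebra.TensorProduct.map (AlgHom.id k H)
      (Algebra.TensorProduct.map Q.counit (AlgHom.id k H)) w = 1)
    (G : H ⊗[k] (H ⊗[k] H) →ₗ[k] N)
    (hG : ∀ a b c, G (a ⊗ₜ (b ⊗ₜ c)) = Q.counit b • G (a ⊗ₜ (1 ⊗ₜ c))) : G w = G 1 := by
  have h : ∀ w, G w = G (Algebra.TensorProduct.map (AlgHom.id k H)
      (Algebra.TensorProduct.map (Algebra.ofId k H) (AlgHom.id k H))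
      (Algebra.TensorProduct.map (AlgHom.id k H)
      (Algebra.TensorProduct.map Q.counit (AlgHom.id k H)) w)) := by
    intro w
    induction w using induction_three with
    | zero => simp
    | add x y hx hy => simp only [map_add, hx, hy]
    | tmul a b c =>
      rw [hG]
      simp [Algebra.ofId_apply, Algebra.algebraMap_eq_smul_one, ← smul_tmul']
  rw [h, hw, map_one]

theorem eq_of_counit_trd {w : H ⊗[k] (H ⊗[k] H)}
    (hw : Algebra.TensorProduct.map (AlgHom.id k H)
      (Algebra.TensorProduct.map (AlgHom.id k H) Q.counit) w = 1)
    (G : H ⊗[k] (H ⊗[k] H) →ₗ[k] N)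
    (hG : ∀ a b c, G (a ⊗ₜ (b ⊗ₜ c)) = Q.counit c • G (a ⊗ₜ (b ⊗ₜ 1))) : G w = G 1 := by
  have h : ∀ w, G w = G (Algebra.TensorProduct.map (AlgHom.id k H)
      (Algebra.TensorProduct.map (AlgHom.id k H) (Algebra.ofId k H))
      (Algebra.TensorProduct.map (AlgHom.id k H)
      (Algebra.TensorProduct.map (AlgHom.id k H) Q.counit) w)) := by
    intro w
    induction w using induction_three with
    | zero => simp
    | add x y hx hy => simp only [map_add, hx, hy]
    | tmul a b c =>
      rw [hG]
      simp [Algebra.ofId_apply, Algebra.algebraMap_eq_smul_one]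
  rw [h, hw, map_one]

theorem apply_comul_left (G : H ⊗[k] H →ₗ[k] N)
    (F : H →ₗ[k] N) (hG : ∀ a b, G (a ⊗ₜ b) = Q.counit a • F b) (h : H) :
    G (Q.comul h) = F h := by
  have key : ∀ w, G w = F (TensorProduct.lid k H
      (Algebra.TensorProduct.map Q.counit (AlgHom.id k H) w)) := by
    intro w
    induction w with
    | zero => simp
    | add x y hx hy => simp only [map_add, hx, hy]
    | tmul a b => simp [hG]
  rw [key, Q.counit_id_comul]; simp

theorem apply_comul_right (G : H ⊗[k] H →ₗ[k] N)
    (F : H →ₗ[k] N) (hG : ∀ a b, G (a ⊗ₜ b) = Q.counit b • F a) (h : H) :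
    G (Q.comul h) = F h := by
  have key : ∀ w, G w = F (TensorProduct.rid k H
      (Algebra.TensorProduct.map (AlgHom.id k H) Q.counit w)) := by
    intro w
    induction w with
    | zero => simp
    | add x y hx hy => simp only [map_add, hx, hy]
    | tmul a b => simp [hG]
  rw [key, Q.id_counit_comul]; simp

end counit

end QuasiBialgebra

/-! ### Antipode axioms rewritten for `S⁻¹`. -/

namespace QuasiHopfAlgebra

set_option maxSynthPendingDepth 6

open TensorProduct QuasiBialgebra

variable {k H : Type*} [Field k] [Ring H] [Algebra k H] (Q : QuasiHopfAlgebra k H)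

/-- The antipode `S`, as a linear endomorphism of `H`. -/
def S : H →ₗ[k] H := antiLin Q.antipode

/-- The inverse `S⁻¹` of the antipode, as a linear endomorphism of `H`. -/
def sinv : H →ₗ[k] H :=
  Q.antipode.symm.toLinearMap ∘ₗ (MulOpposite.opLinearEquiv k : H ≃ₗ[k] Hᵐᵒᵖ).toLinearMap

theorem S_mul (a b : H) : Q.S (a * b) = Q.S b * Q.S a := by
  simp [S, antiLin]

theorem sinv_mul (a b : H) : Q.sinv (a * b) = Q.sinv b * Q.sinv a := by
  simp [sinv]

theorem sinv_one : Q.sinv 1 = 1 := by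
  simp [sinv]

theorem sinv_S (a : H) : Q.sinv (Q.S a) = a := by
  simp [S, sinv, antiLin]

/-- `S⁻¹(α)` -/
def alphaInv : H := Q.sinv Q.alpha

/-- `S⁻¹(β)` -/
def betaInv : H := Q.sinv Q.beta

/-- `a ⊗ b ↦ S⁻¹(b) S⁻¹(α) a` -/
def ev : H ⊗[k] H →ₗ[k] H :=
  lift (LinearMap.mk₂ k (fun a b => Q.sinv b * Q.alphaInv * a)
    (by intros; simp [mul_add]) (by intros; simp)
    (by intros; simp [add_mul]) (by intros; simp))

/-- `a ⊗ b ↦ b S⁻¹(β) S⁻¹(a)` -/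
def coev : H ⊗[k] H →ₗ[k] H :=
  lift (LinearMap.mk₂ k (fun a b => b * Q.betaInv * Q.sinv a)
    (by intros; simp [mul_add]) (by intros; simp)
    (by intros; simp [add_mul]) (by intros; simp))

/-- `a ⊗ b ↦ a β S(b)` -/
def coevS : H ⊗[k] H →ₗ[k] H :=
  lift (LinearMap.mk₂ k (fun a b => a * Q.beta * Q.S b)
    (by intros; simp [add_mul]) (by intros; simp)
    (by intros; simp [mul_add]) (by intros; simp))

/-- `a ⊗ b ↦ S(a) α b` -/
def evS : H ⊗[k] H →ₗ[k] H :=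
  lift (LinearMap.mk₂ k (fun a b => Q.S a * Q.alpha * b)
    (by intros; simp [add_mul]) (by intros; simp)
    (by intros; simp [mul_add]) (by intros; simp))

@[simp] theorem ev_tmul (a b : H) : Q.ev (a ⊗ₜ b) = Q.sinv b * Q.alphaInv * a := rfl
@[simp] theorem coev_tmul (a b : H) : Q.coev (a ⊗ₜ b) = b * Q.betaInv * Q.sinv a := rfl
@[simp] theorem evS_tmul (a b : H) : Q.evS (a ⊗ₜ b) = Q.S a * Q.alpha * b := rfl
@[simp] theorem coevS_tmul (a b : H) : Q.coevS (a ⊗ₜ b) = a * Q.beta * Q.S b := rfl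

theorem evS_comul (h : H) : Q.evS (Q.comul h) = Q.counit h • Q.alpha := by
  have : Q.evS = LinearMap.mul' k H ∘ₗ
      TensorProduct.map (LinearMap.mulRight k Q.alpha ∘ₗ antiLin Q.antipode) LinearMap.id := by
    ext a b; rfl
  rw [this, ← Q.antipode_alpha h]; rfl

theorem coevS_comul (h : H) : Q.coevS (Q.comul h) = Q.counit h • Q.beta := by
  have : Q.coevS = LinearMap.mul' k H ∘ₗ
      TensorProduct.map (LinearMap.mulRight k Q.beta) (antiLin Q.antipode) := by
    ext a b; rfl
  rw [this, ← Q.beta_antipode h]; rfl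

/-- `S⁻¹` reverses products, so each antipode axiom transfers to `ev` and `coev` by applying `S⁻¹`
to it. -/
theorem ev_eq : Q.ev = Q.sinv ∘ₗ Q.evS := by
  ext a b; simp [sinv_mul, sinv_S, alphaInv, mul_assoc]

theorem coev_eq : Q.coev = Q.sinv ∘ₗ Q.coevS := by
  ext a b; simp [sinv_mul, sinv_S, betaInv, mul_assoc]

theorem ev_comul (h : H) : Q.ev (Q.comul h) = Q.counit h • Q.alphaInv := by
  rw [ev_eq, LinearMap.comp_apply, evS_comul, map_smul]; rfl

theorem coev_comul (h : H) : Q.coev (Q.comul h) = Q.counit h • Q.betaInv := by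
  rw [coev_eq, LinearMap.comp_apply, coevS_comul, map_smul]; rfl

theorem ev_mul_tmul (d : H ⊗[k] H) (a b : H) :
    Q.ev (d * (a ⊗ₜ b)) = Q.sinv b * Q.ev d * a := by
  induction d with
  | zero => simp
  | add x y hx hy => simp only [add_mul, mul_add, map_add, hx, hy]
  | tmul x y => simp [sinv_mul, mul_assoc]

theorem coev_tmul_mul (d : H ⊗[k] H) (a b : H) :
    Q.coev ((a ⊗ₜ b) * d) = b * Q.coev d * Q.sinv a := by
  induction d with
  | zero => simp
  | add x y hx hy => simp only [add_mul, mul_add, map_add, hx, hy]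
  | tmul x y => simp [sinv_mul, mul_assoc]

/-- The legs of `w` come out on the two sides of `ev`, leaving `ev (Δ(h)) = ε(h) S⁻¹(α)` in the
middle. -/
theorem ev_comul_mul (h : H) (w : H ⊗[k] H) :
    Q.ev (Q.comul h * w) = Q.counit h • Q.ev w := by
  induction w with
  | zero => simp
  | add x y hx hy => simp only [mul_add, map_add, hx, hy, smul_add]
  | tmul a b => simp [ev_mul_tmul, ev_comul]

theorem coev_mul_comul (h : H) (w : H ⊗[k] H) :
    Q.coev (w * Q.comul h) = Q.counit h • Q.coev w := by
  induction w with
  | zero => simp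
  | add x y hx hy => simp only [add_mul, map_add, hx, hy, smul_add]
  | tmul a b => simp [coev_tmul_mul, coev_comul]

/-- `a ⊗ b ⊗ c ↦ S⁻¹(c) S⁻¹(α) b S⁻¹(β) S⁻¹(a)` -/
def zigzag : H ⊗[k] (H ⊗[k] H) →ₗ[k] H :=
  lift (LinearMap.mk₂ k (fun a w => Q.ev w * (Q.betaInv * Q.sinv a))
    (by intros; simp [mul_add]) (by intros; simp)
    (by intros; simp [add_mul]) (by intros; simp))

@[simp] theorem zigzag_tmul (a : H) (w : H ⊗[k] H) :
    Q.zigzag (a ⊗ₜ w) = Q.ev w * (Q.betaInv * Q.sinv a) := rfl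

/-- `a ⊗ b ⊗ c ↦ c S⁻¹(β) S⁻¹(b) S⁻¹(α) a` -/
def zagzig : H ⊗[k] (H ⊗[k] H) →ₗ[k] H :=
  lift (LinearMap.mk₂ k (fun a w => Q.coev w * (Q.alphaInv * a))
    (by intros; simp [mul_add]) (by intros; simp)
    (by intros; simp [add_mul]) (by intros; simp))

@[simp] theorem zagzig_tmul (a : H) (w : H ⊗[k] H) :
    Q.zagzig (a ⊗ₜ w) = Q.coev w * (Q.alphaInv * a) := rfl

/-- `a ⊗ b ⊗ c ↦ a β S(b) α c` -/
def zigzagS : H ⊗[k] (H ⊗[k] H) →ₗ[k] H :=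
  lift (LinearMap.mk₂ k (fun a w => a * Q.beta * Q.evS w)
    (by intros; simp [add_mul]) (by intros; simp)
    (by intros; simp [mul_add]) (by intros; simp))

@[simp] theorem zigzagS_tmul (a : H) (w : H ⊗[k] H) :
    Q.zigzagS (a ⊗ₜ w) = a * Q.beta * Q.evS w := rfl

theorem zigzagS_reassoc : Q.zigzagS Q.reassoc = 1 := by
  have : Q.zigzagS = LinearMap.mul' k H ∘ₗ
      (TensorProduct.map (LinearMap.mulRight k Q.beta)
        (LinearMap.mul' k H ∘ₗ
          TensorProduct.map (LinearMap.mulRight k Q.alpha ∘ₗ antiLin Q.antipode)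
            LinearMap.id)) := by
    ext a b c; rfl
  rw [this, ← Q.reassoc_antipode]; rfl

theorem zigzag_reassoc : Q.zigzag Q.reassoc = 1 := by
  have : Q.zigzag = Q.sinv ∘ₗ Q.zigzagS := by
    ext a b c; simp [sinv_mul, sinv_S, alphaInv, betaInv, mul_assoc]
  rw [this, LinearMap.comp_apply, zigzagS_reassoc, sinv_one]

theorem zagzig_reassocInv : Q.zagzig Q.reassocInv = 1 := by
  have : Q.zagzig = Q.sinv ∘ₗ LinearMap.mul' k H ∘ₗ
      (TensorProduct.map (LinearMap.mulRight k Q.alpha ∘ₗ antiLin Q.antipode)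
        (LinearMap.mul' k H ∘ₗ
          TensorProduct.map (LinearMap.mulRight k Q.beta) (antiLin Q.antipode))) := by
    ext a b c
    change _ = Q.sinv ((Q.S a * Q.alpha) * (b * Q.beta * Q.S c))
    simp [sinv_mul, sinv_S, alphaInv, betaInv, mul_assoc]
  rw [this, LinearMap.comp_apply, LinearMap.comp_apply]
  erw [Q.reassoc_inv_antipode]
  exact Q.sinv_one

/-! ### Construction of the twist and its intertwining property. -/

/-- `a ⊗ b ↦ Δ(b) q (S⁻¹(a) ⊗ 1)` -/
def actTwo (q : H ⊗[k] H) : H ⊗[k] H →ₗ[k] H ⊗[k] H :=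
  lift (LinearMap.mk₂ k (fun a b => Q.comul b * q * (Q.sinv a ⊗ₜ 1))
    (by intros; simp [mul_add, add_tmul])
    (by intros; rw [map_smul, ← smul_tmul', mul_smul_comm])
    (by intros; simp [add_mul]) (by intros; simp))

@[simp] theorem actTwo_tmul (q : H ⊗[k] H) (a b : H) :
    Q.actTwo q (a ⊗ₜ b) = Q.comul b * q * (Q.sinv a ⊗ₜ 1) := rfl

/-- `a ⊗ b ⊗ c ↦ b S⁻¹(β) S⁻¹(a) ⊗ c` -/
def coevThree : H ⊗[k] (H ⊗[k] H) →ₗ[k] H ⊗[k] H :=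
  TensorProduct.map Q.coev LinearMap.id ∘ₗ (TensorProduct.assoc k H H H).symm.toLinearMap

theorem coevThree_assoc (d : H ⊗[k] H) (c : H) :
    Q.coevThree (TensorProduct.assoc k H H H (d ⊗ₜ c)) = Q.coev d ⊗ₜ c := by
  simp [coevThree]

theorem coevThree_tmul (a b c : H) :
    Q.coevThree (a ⊗ₜ (b ⊗ₜ c)) = Q.coev (a ⊗ₜ b) ⊗ₜ c := rfl

theorem tmul_mul_assoc (a b c : H) (d : H ⊗[k] H) (e : H) :
    (a ⊗ₜ[k] (b ⊗ₜ[k] c)) * TensorProduct.assoc k H H H (d ⊗ₜ e) =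
      TensorProduct.assoc k H H H ((a ⊗ₜ b * d) ⊗ₜ (c * e)) := by
  induction d with
  | zero => simp
  | add x y hx hy => simp only [add_tmul, mul_add, map_add, hx, hy]
  | tmul x y => simp

theorem assoc_mul_tmul (d : H ⊗[k] H) (e : H) (a b c : H) :
    TensorProduct.assoc k H H H (d ⊗ₜ e) * (a ⊗ₜ[k] (b ⊗ₜ[k] c)) =
      TensorProduct.assoc k H H H ((d * a ⊗ₜ b) ⊗ₜ (e * c)) := by
  induction d with
  | zero => simp
  | add x y hx hy => simp only [add_tmul, add_mul, map_add, hx, hy]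
  | tmul x y => simp

theorem coevThree_mul_comulLeft (w : H ⊗[k] (H ⊗[k] H)) (h : H) :
    Q.coevThree (w * Q.comulLeft (Q.comul h)) = Q.coevThree w * (1 ⊗ₜ h) := by
  refine Q.apply_comul_left (Q.coevThree ∘ₗ LinearMap.mulLeft k w ∘ₗ Q.comulLeft.toLinearMap)
    (LinearMap.mulLeft k (Q.coevThree w) ∘ₗ TensorProduct.mk k H H 1) (fun a b => ?_) h
  change Q.coevThree (w * Q.comulLeft (a ⊗ₜ b)) = Q.counit a • (Q.coevThree w * (1 ⊗ₜ b))
  induction w using induction_three with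
  | zero => simp
  | add x y hx hy => simp only [add_mul, map_add, hx, hy, smul_add]
  | tmul x y z =>
    rw [comulLeft_tmul, tmul_mul_assoc, coevThree_assoc, coev_mul_comul, coevThree_tmul]
    simp [smul_tmul']

theorem coevThree_comulRight_mul (v : H ⊗[k] H) (w : H ⊗[k] (H ⊗[k] H)) :
    Q.coevThree (Q.comulRight v * w) = Q.actTwo (Q.coevThree w) v := by
  induction v with
  | zero => simp
  | add x y hx hy => simp only [add_mul, map_add, hx, hy]
  | tmul a b =>
    rw [comulRight_tmul, actTwo_tmul]
    generalize Q.comul b = d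
    induction w using induction_three with
    | zero => simp
    | add x y hx hy => simp only [mul_add, add_mul, map_add, hx, hy]
    | tmul x y z =>
      induction d with
      | zero => simp
      | add p q hp hq => simp only [tmul_add, add_mul, map_add, hp, hq]
      | tmul p q => simp [coevThree_tmul, sinv_mul, mul_assoc]

/-- `X² S⁻¹(X¹ β) ⊗ X³` -/
def pL : H ⊗[k] H := Q.coevThree Q.reassoc

/-- Quasi-coassociativity carries the iterated coproduct of `h` across `Φ`; there its first two legs
meet in `coev` and collapse to a counit. -/
theorem actTwo_pL (h : H) : Q.actTwo Q.pL (Q.comul h) = Q.pL * (1 ⊗ₜ h) := by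
  rw [pL, ← coevThree_comulRight_mul, comulRight_comul_mul_reassoc, coevThree_mul_comulLeft]

/-- `a ⊗ b ⊗ c ↦ Δ(S⁻¹(c) S⁻¹(α) b) pL (S⁻¹(a) ⊗ 1)` -/
def preTwist : H ⊗[k] (H ⊗[k] H) →ₗ[k] H ⊗[k] H :=
  lift (LinearMap.mk₂ k (fun a w => Q.comul (Q.ev w) * (Q.pL * (Q.sinv a ⊗ₜ 1)))
    (by intros; simp [mul_add, add_tmul])
    (by intros; rw [map_smul, ← smul_tmul', mul_smul_comm, mul_smul_comm])
    (by intros; simp [add_mul]) (by intros; simp))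

@[simp] theorem preTwist_tmul (a : H) (w : H ⊗[k] H) :
    Q.preTwist (a ⊗ₜ w) = Q.comul (Q.ev w) * (Q.pL * (Q.sinv a ⊗ₜ 1)) := rfl

/-- `a ⊗ b ↦ Δ(S⁻¹(b)) q (1 ⊗ a)` -/
def coactTwo (q : H ⊗[k] H) : H ⊗[k] H →ₗ[k] H ⊗[k] H :=
  lift (LinearMap.mk₂ k (fun a b => Q.comul (Q.sinv b) * q * (1 ⊗ₜ a))
    (by intros; simp [mul_add, tmul_add])
    (by intros; rw [tmul_smul, mul_smul_comm])
    (by intros; simp [add_mul]) (by intros; simp))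

@[simp] theorem coactTwo_tmul (q : H ⊗[k] H) (a b : H) :
    Q.coactTwo q (a ⊗ₜ b) = Q.comul (Q.sinv b) * q * (1 ⊗ₜ a) := rfl

theorem preTwist_mul_comulLeft (w : H ⊗[k] (H ⊗[k] H)) (v : H ⊗[k] H) :
    Q.preTwist (w * Q.comulLeft v) = Q.coactTwo (Q.preTwist w) v := by
  induction v with
  | zero => simp
  | add x y hx hy => simp only [mul_add, map_add, hx, hy]
  | tmul a b =>
    induction w using induction_three with
    | zero => simp
    | add x y hx hy => simp only [add_mul, mul_add, map_add, hx, hy, coactTwo_tmul]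
    | tmul x y z =>
      -- The two legs of `d = Δ(a)` end up on opposite sides of `pL`, which is the configuration
      -- that `actTwo_pL` collapses.
      have key : ∀ d : H ⊗[k] H,
          Q.preTwist (TensorProduct.assoc k H H H ((x ⊗ₜ y * d) ⊗ₜ (z * b))) =
          Q.comul (Q.sinv b) * Q.comul (Q.ev (y ⊗ₜ z)) * Q.actTwo Q.pL d * (Q.sinv x ⊗ₜ 1) := by
        intro d
        induction d with
        | zero => simp
        | add p q hp hq => simp only [add_tmul, mul_add, add_mul, map_add, hp, hq]
        | tmul p q => simp [sinv_mul, mul_assoc]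
      rw [comulLeft_tmul, tmul_mul_assoc, key, actTwo_pL]
      simp [mul_assoc]

theorem preTwist_comulRight_mul (h : H) (w : H ⊗[k] (H ⊗[k] H)) :
    Q.preTwist (Q.comulRight (Q.comul h) * w) = Q.preTwist w * (Q.sinv h ⊗ₜ 1) := by
  refine Q.apply_comul_right
    (Q.preTwist ∘ₗ LinearMap.mulRight k w ∘ₗ Q.comulRight.toLinearMap)
    (LinearMap.mulLeft k (Q.preTwist w) ∘ₗ (TensorProduct.mk k H H).flip 1 ∘ₗ Q.sinv)
    (fun a b => ?_) h
  change Q.preTwist (Q.comulRight (a ⊗ₜ b) * w) =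
    Q.counit b • (Q.preTwist w * (Q.sinv a ⊗ₜ 1))
  induction w using induction_three with
  | zero => simp
  | add x y hx hy => simp only [add_mul, mul_add, map_add, hx, hy, smul_add]
  | tmul x y z =>
    simp [ev_comul_mul, sinv_mul, mul_assoc]

/-- The element `g` of `H ⊗ H` with `Δ(S⁻¹(h₂)) g (1 ⊗ h₁) = g (S⁻¹(h) ⊗ 1)`, which turns the
coaction of a Hopf bimodule into an action of `H*`. -/
def twist : H ⊗[k] H := Q.preTwist Q.reassoc

/-- The iterated coproduct of `h` enters on the right of `Φ`, crosses it by quasi-coassociativity,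
and on the left its last two legs meet in `ev`. Only `S⁻¹(h)` on the far right survives. -/
theorem coactTwo_twist (h : H) :
    Q.coactTwo Q.twist (Q.comul h) = Q.twist * (Q.sinv h ⊗ₜ 1) := by
  rw [twist, ← preTwist_mul_comulLeft, ← comulRight_comul_mul_reassoc, preTwist_comulRight_mul]

/-! ### The twist multiplied by `S⁻¹(α) ⊗ 1`. -/

theorem assoc_mul_tmul_tmul (d u : H ⊗[k] H) (a b : H) (w : H ⊗[k] H) :
    TensorProduct.assoc k H H (H ⊗[k] H) (d ⊗ₜ u) * (a ⊗ₜ[k] (b ⊗ₜ[k] w)) =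
      TensorProduct.assoc k H H (H ⊗[k] H) ((d * a ⊗ₜ b) ⊗ₜ (u * w)) := by
  induction d with
  | zero => simp
  | add x y hx hy => simp only [add_tmul, add_mul, map_add, hx, hy]
  | tmul x y => simp

theorem actTwo_tmul_mul (q : H ⊗[k] H) (a b : H) (d : H ⊗[k] H) :
    Q.actTwo q (a ⊗ₜ b * d) = Q.comul b * Q.actTwo q d * (Q.sinv a ⊗ₜ 1) := by
  induction d with
  | zero => simp
  | add x y hx hy => simp only [add_mul, mul_add, map_add, hx, hy]
  | tmul x y => simp [sinv_mul, mul_assoc]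

/-- `a ⊗ b ⊗ c ⊗ d ↦ Δ(S⁻¹(d) S⁻¹(α) c) pL (S⁻¹(b) S⁻¹(α) a ⊗ 1)` -/
def evFour : H ⊗[k] (H ⊗[k] (H ⊗[k] H)) →ₗ[k] H ⊗[k] H :=
  lift (LinearMap.mk₂ k (fun d w => Q.comul (Q.ev w) * (Q.pL * (Q.ev d ⊗ₜ 1)))
    (by intros; simp [mul_add, add_tmul])
    (by intros; rw [map_smul, ← smul_tmul', mul_smul_comm, mul_smul_comm])
    (by intros; simp [add_mul]) (by intros; simp)) ∘ₗ
  (TensorProduct.assoc k H H (H ⊗[k] H)).symm.toLinearMap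

theorem evFour_assoc (d w : H ⊗[k] H) :
    Q.evFour (TensorProduct.assoc k H H (H ⊗[k] H) (d ⊗ₜ w)) =
      Q.comul (Q.ev w) * (Q.pL * (Q.ev d ⊗ₜ 1)) := by
  simp [evFour]

theorem evFour_tmul (a b : H) (w : H ⊗[k] H) :
    Q.evFour (a ⊗ₜ (b ⊗ₜ w)) = Q.comul (Q.ev w) * (Q.pL * (Q.ev (a ⊗ₜ b) ⊗ₜ 1)) := rfl

theorem evFour_one_tmul (w : H ⊗[k] (H ⊗[k] H)) :
    Q.evFour (1 ⊗ₜ w) = Q.preTwist w * (Q.alphaInv ⊗ₜ 1) := by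
  induction w with
  | zero => simp
  | add x y hx hy => simp only [tmul_add, add_mul, map_add, hx, hy]
  | tmul x y => simp [evFour_tmul, mul_assoc]

theorem evFour_comulTrd_mul (y : H ⊗[k] (H ⊗[k] (H ⊗[k] H))) :
    Q.evFour (Q.comulTrd Q.reassocInv * y) = Q.evFour y := by
  have := Q.eq_of_counit_trd Q.counit_trd_inv
    (Q.evFour ∘ₗ LinearMap.mulRight k y ∘ₗ Q.comulTrd.toLinearMap) (fun a b c => by
      change Q.evFour (Q.comulTrd (a ⊗ₜ (b ⊗ₜ c)) * y) =
        Q.counit c • Q.evFour (Q.comulTrd (a ⊗ₜ (b ⊗ₜ 1)) * y)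
      induction y using induction_four with
      | zero => simp
      | add x y hx hy => simp only [mul_add, map_add, hx, hy, smul_add]
      | tmul p q r s => simp [evFour_tmul, ev_comul_mul])
  refine this.trans ?_
  change Q.evFour (Q.comulTrd 1 * y) = _
  rw [map_one, one_mul]

theorem evFour_comulFst_mul (y : H ⊗[k] (H ⊗[k] (H ⊗[k] H))) :
    Q.evFour (Q.comulFst Q.reassoc * y) = Q.evFour y := by
  have := Q.eq_of_counit_fst Q.counit_fst
    (Q.evFour ∘ₗ LinearMap.mulRight k y ∘ₗ Q.comulFst.toLinearMap) (fun a b c => by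
      change Q.evFour (Q.comulFst (a ⊗ₜ (b ⊗ₜ c)) * y) =
        Q.counit a • Q.evFour (Q.comulFst (1 ⊗ₜ (b ⊗ₜ c)) * y)
      induction y using induction_four with
      | zero => simp
      | add x y hx hy => simp only [mul_add, map_add, hx, hy, smul_add]
      | tmul p q r s =>
        rw [comulFst_tmul, comulFst_tmul, assoc_mul_tmul_tmul, assoc_mul_tmul_tmul,
          evFour_assoc, evFour_assoc, ev_comul_mul, ev_comul_mul]
        simp [← smul_tmul'])
  refine this.trans ?_
  change Q.evFour (Q.comulFst 1 * y) = _
  rw [map_one, one_mul]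

theorem evFour_tmul_assoc (a c : H) (e : H ⊗[k] H) :
    Q.evFour (a ⊗ₜ TensorProduct.assoc k H H H (e ⊗ₜ c)) =
      Q.comul (Q.sinv c * Q.alphaInv) * Q.actTwo Q.pL e * ((Q.alphaInv * a) ⊗ₜ 1) := by
  induction e with
  | zero => simp
  | add x y hx hy => simp only [add_tmul, tmul_add, add_mul, mul_add, map_add, hx, hy]
  | tmul x y => simp [evFour_tmul, mul_assoc]

/-- `a ⊗ b ⊗ c ↦ Δ(c) pL (S⁻¹(b) S⁻¹(α) a ⊗ 1)` -/
def evThree : H ⊗[k] (H ⊗[k] H) →ₗ[k] H ⊗[k] H :=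
  lift (LinearMap.mk₂ k (fun d c => Q.comul c * (Q.pL * (Q.ev d ⊗ₜ 1)))
    (by intros; simp [mul_add, add_tmul])
    (by intros; rw [map_smul, ← smul_tmul', mul_smul_comm, mul_smul_comm])
    (by intros; simp [add_mul]) (by intros; simp)) ∘ₗ
  (TensorProduct.assoc k H H H).symm.toLinearMap

theorem evThree_tmul (a b c : H) :
    Q.evThree (a ⊗ₜ (b ⊗ₜ c)) = Q.comul c * (Q.pL * (Q.ev (a ⊗ₜ b) ⊗ₜ 1)) := rfl

/-- `a ⊗ b ⊗ c ⊗ d ↦ c S⁻¹(β) S⁻¹(b) S⁻¹(α) a ⊗ d` -/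
def zagzigFour : H ⊗[k] (H ⊗[k] (H ⊗[k] H)) →ₗ[k] H ⊗[k] H :=
  lift (LinearMap.mk₂ k (fun d w => w * ((Q.betaInv * Q.ev d) ⊗ₜ 1))
    (by intros; simp [mul_add, add_tmul])
    (by intros; rw [map_smul, mul_smul_comm, ← smul_tmul', mul_smul_comm])
    (by intros; simp [add_mul]) (by intros; simp)) ∘ₗ
  (TensorProduct.assoc k H H (H ⊗[k] H)).symm.toLinearMap

theorem zagzigFour_assoc (d w : H ⊗[k] H) :
    Q.zagzigFour (TensorProduct.assoc k H H (H ⊗[k] H) (d ⊗ₜ w)) =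
      w * ((Q.betaInv * Q.ev d) ⊗ₜ 1) := by
  simp [zagzigFour]

theorem zagzigFour_tmul_tmul (a b : H) (w : H ⊗[k] H) :
    Q.zagzigFour (a ⊗ₜ (b ⊗ₜ w)) = w * ((Q.betaInv * Q.ev (a ⊗ₜ b)) ⊗ₜ 1) := rfl

theorem zagzigFour_tmul (a : H) (w : H ⊗[k] (H ⊗[k] H)) :
    Q.zagzigFour (a ⊗ₜ w) = Q.coevThree w * ((Q.alphaInv * a) ⊗ₜ 1) := by
  induction w using induction_three with
  | zero => simp
  | add x y hx hy => simp only [tmul_add, add_mul, map_add, hx, hy]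
  | tmul x y z => simp [zagzigFour_tmul_tmul, coevThree_tmul, mul_assoc]

theorem zagzigFour_comulFst_mul (y : H ⊗[k] (H ⊗[k] (H ⊗[k] H))) :
    Q.zagzigFour (Q.comulFst Q.reassoc * y) = Q.zagzigFour y := by
  have := Q.eq_of_counit_fst Q.counit_fst
    (Q.zagzigFour ∘ₗ LinearMap.mulRight k y ∘ₗ Q.comulFst.toLinearMap) (fun a b c => by
      change Q.zagzigFour (Q.comulFst (a ⊗ₜ (b ⊗ₜ c)) * y) =
        Q.counit a • Q.zagzigFour (Q.comulFst (1 ⊗ₜ (b ⊗ₜ c)) * y)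
      induction y using induction_four with
      | zero => simp
      | add x y hx hy => simp only [mul_add, map_add, hx, hy, smul_add]
      | tmul p q r s =>
        rw [comulFst_tmul, comulFst_tmul, assoc_mul_tmul_tmul, assoc_mul_tmul_tmul,
          zagzigFour_assoc, zagzigFour_assoc, ev_comul_mul, ev_comul_mul]
        simp [← smul_tmul'])
  refine this.trans ?_
  change Q.zagzigFour (Q.comulFst 1 * y) = _
  rw [map_one, one_mul]

theorem zagzigFour_mul_comulSnd (u : H ⊗[k] (H ⊗[k] H)) :
    Q.zagzigFour (appendThree k H u * Q.comulSnd Q.reassocInv) =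
      Q.zagzigFour (appendThree k H u) := by
  have := Q.eq_of_counit_snd Q.counit_snd_inv
    (Q.zagzigFour ∘ₗ LinearMap.mulLeft k (appendThree k H u) ∘ₗ Q.comulSnd.toLinearMap)
    (fun a b c => by
      change Q.zagzigFour (appendThree k H u * Q.comulSnd (a ⊗ₜ (b ⊗ₜ c))) =
        Q.counit b • Q.zagzigFour (appendThree k H u * Q.comulSnd (a ⊗ₜ (1 ⊗ₜ c)))
      induction u using induction_three with
      | zero => simp
      | add x y hx hy => simp only [add_mul, map_add, hx, hy, smul_add]
      | tmul x y z =>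
        rw [comulSnd_tmul, comulSnd_tmul, appendThree_tmul, appendTwo_tmul, comulLeft_tmul,
          comulLeft_tmul, Algebra.TensorProduct.tmul_mul_tmul,
          Algebra.TensorProduct.tmul_mul_tmul, tmul_mul_assoc, tmul_mul_assoc,
          zagzigFour_tmul, zagzigFour_tmul, coevThree_assoc, coevThree_assoc, coev_mul_comul,
          coev_mul_comul]
        simp [← smul_tmul'])
  refine this.trans ?_
  change Q.zagzigFour (appendThree k H u * Q.comulSnd 1) = _
  rw [map_one, mul_one]

theorem zagzigFour_appendThree (u : H ⊗[k] (H ⊗[k] H)) :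
    Q.zagzigFour (appendThree k H u) = Q.zagzig u ⊗ₜ 1 := by
  induction u using induction_three with
  | zero => simp
  | add x y hx hy => simp only [add_tmul, map_add, hx, hy]
  | tmul x y z => simp [zagzigFour_tmul, coevThree_tmul]

theorem evThree_eq (z : H ⊗[k] (H ⊗[k] H)) :
    Q.evThree z = Q.zagzigFour
      (Q.comulTrd z * ((1 : H) ⊗ₜ[k] (Q.reassoc : H ⊗[k] (H ⊗[k] H)))) := by
  induction z using induction_three with
  | zero => simp
  | add x y hx hy => simp only [add_mul, map_add, hx, hy]
  | tmul a b c =>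
    rw [comulTrd_tmul, Algebra.TensorProduct.tmul_mul_tmul, zagzigFour_tmul,
      coevThree_comulRight_mul, evThree_tmul]
    simp [pL, mul_assoc]

/-- Rewriting `pL` through `Φ` makes the left side `zagzigFour` of one side of the pentagon. On the
other side the outer factors are erased by counits, and `Φ⁻¹ ⊗ 1` contributes the axiom `S(x¹) α x²
β S(x³) = 1` transported by `S⁻¹`. -/
theorem evThree_reassocInv : Q.evThree Q.reassocInv = 1 := by
  rw [evThree_eq, comulTrd_inv_mul, mul_assoc, zagzigFour_comulFst_mul, zagzigFour_mul_comulSnd,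
    zagzigFour_appendThree, zagzig_reassocInv]
  rfl

/-- `a ⊗ b ⊗ c ↦ Δ(S⁻¹(c) S⁻¹(α)) (a ⊗ b)` -/
def comulEv : H ⊗[k] (H ⊗[k] H) →ₗ[k] H ⊗[k] H :=
  lift (LinearMap.mk₂ k (fun d c => Q.comul (Q.sinv c * Q.alphaInv) * d)
    (by intros; simp [mul_add]) (by intros; simp)
    (by intros; simp [add_mul]) (by intros; simp)) ∘ₗ
  (TensorProduct.assoc k H H H).symm.toLinearMap

@[simp] theorem comulEv_tmul (a b c : H) :
    Q.comulEv (a ⊗ₜ (b ⊗ₜ c)) = Q.comul (Q.sinv c * Q.alphaInv) * (a ⊗ₜ b) := rfl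

theorem evFour_append_mul_comulSnd (u : H ⊗[k] (H ⊗[k] H)) (a b c : H) :
    Q.evFour (appendThree k H u * Q.comulSnd (a ⊗ₜ (b ⊗ₜ c))) =
      Q.comul (Q.sinv c * Q.alphaInv) * Q.evThree u * (a ⊗ₜ b) := by
  induction u using induction_three with
  | zero => simp
  | add x y hx hy => simp only [add_mul, mul_add, map_add, hx, hy]
  | tmul x y z =>
    rw [comulSnd_tmul, appendThree_tmul, appendTwo_tmul, comulLeft_tmul,
      Algebra.TensorProduct.tmul_mul_tmul, tmul_mul_assoc, evFour_tmul_assoc, actTwo_tmul_mul,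
      actTwo_pL, evThree_tmul]
    simp [mul_assoc]

/-- The left side is `evFour (1 ⊗ Φ)`. A factor `(id ⊗ id ⊗ Δ)(Φ⁻¹)` may be inserted freely, after
which the pentagon applies; its first factor is erased by a counit, and what `Φ⁻¹ ⊗ 1` contributes
is `evThree Φ⁻¹ = 1`. The resulting formula is free of `β`, which makes `twist` tractable in the
sequel. -/
theorem twist_mul_alphaInv : Q.twist * (Q.alphaInv ⊗ₜ 1) = Q.comulEv Q.reassocInv := by
  have h : ∀ w, Q.evFour (appendThree k H Q.reassocInv * Q.comulSnd w) = Q.comulEv w := by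
    intro w
    induction w using induction_three with
    | zero => simp
    | add x y hx hy => simp only [mul_add, map_add, hx, hy]
    | tmul a b c => rw [evFour_append_mul_comulSnd, evThree_reassocInv, mul_one, comulEv_tmul]
  rw [twist, ← evFour_one_tmul, ← evFour_comulTrd_mul, comulTrd_inv_mul, mul_assoc,
    evFour_comulFst_mul, h]

/-! ### The cocycle identity for the twist. -/

/-- `a ⊗ b ⊗ c ↦ (Δ ⊗ id)(Δ(S⁻¹(c))) T (1 ⊗ a ⊗ b)` -/
def coactThree (T : H ⊗[k] (H ⊗[k] H)) : H ⊗[k] (H ⊗[k] H) →ₗ[k] H ⊗[k] (H ⊗[k] H) :=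
  lift (LinearMap.mk₂ k (fun d c => Q.comulLeft (Q.comul (Q.sinv c)) * (T * (1 ⊗ₜ d)))
    (by intros; simp [mul_add, tmul_add])
    (by intros; rw [tmul_smul, mul_smul_comm, mul_smul_comm])
    (by intros; simp [add_mul]) (by intros; simp)) ∘ₗ
  (TensorProduct.assoc k H H H).symm.toLinearMap

theorem coactThree_tmul (T : H ⊗[k] (H ⊗[k] H)) (a b c : H) :
    Q.coactThree T (a ⊗ₜ (b ⊗ₜ c)) =
      Q.comulLeft (Q.comul (Q.sinv c)) * (T * (1 ⊗ₜ (a ⊗ₜ b))) := rfl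

theorem coactThree_mul (T v : H ⊗[k] (H ⊗[k] H)) (r : H) :
    Q.coactThree T v * (r ⊗ₜ 1) = Q.coactThree (T * (r ⊗ₜ 1)) v := by
  induction v using induction_three with
  | zero => simp
  | add x y hx hy => simp only [add_mul, map_add, hx, hy]
  | tmul a b c => simp [coactThree_tmul, mul_assoc]

/-- An intertwiner is determined by its product with `S⁻¹(α) ⊗ 1`. Indeed `1 = S⁻¹(X³) S⁻¹(α) X²
S⁻¹(β) S⁻¹(X¹)`; after insertion to the right of `T`, the intertwining property moves `S⁻¹(X³)` to
its left and exposes `S⁻¹(α)`. -/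
theorem eq_of_coactThree {T T' : H ⊗[k] (H ⊗[k] H)}
    (hT : ∀ h, Q.coactThree T (Q.comulRight (Q.comul h)) = T * (Q.sinv h ⊗ₜ 1))
    (hT' : ∀ h, Q.coactThree T' (Q.comulRight (Q.comul h)) = T' * (Q.sinv h ⊗ₜ 1))
    (h : T * (Q.alphaInv ⊗ₜ 1) = T' * (Q.alphaInv ⊗ₜ 1)) : T = T' := by
  have h1 : ∀ c, T * ((Q.alphaInv * c) ⊗ₜ 1) = T' * ((Q.alphaInv * c) ⊗ₜ 1) := by
    intro c
    have e : (Q.alphaInv * c) ⊗ₜ[k] (1 : H ⊗[k] H) = (Q.alphaInv ⊗ₜ 1) * (c ⊗ₜ 1) := by simp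
    rw [e, ← mul_assoc, ← mul_assoc, h]
  have h2 : ∀ l c, T * ((Q.sinv l * (Q.alphaInv * c)) ⊗ₜ 1) =
      T' * ((Q.sinv l * (Q.alphaInv * c)) ⊗ₜ 1) := by
    intro l c
    have e : (Q.sinv l * (Q.alphaInv * c)) ⊗ₜ[k] (1 : H ⊗[k] H) =
      (Q.sinv l ⊗ₜ 1) * ((Q.alphaInv * c) ⊗ₜ 1) := by simp
    rw [e, ← mul_assoc, ← mul_assoc, ← hT, ← hT', coactThree_mul, coactThree_mul, h1]
  have h3 : ∀ w, T * (Q.zigzag w ⊗ₜ 1) = T' * (Q.zigzag w ⊗ₜ 1) := by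
    intro w
    induction w using induction_three with
    | zero => simp
    | add x y hx hy => simp only [map_add, add_tmul, mul_add, hx, hy]
    | tmul a b c =>
      have := h2 c (b * (Q.betaInv * Q.sinv a))
      simpa [mul_assoc] using this
  have := h3 Q.reassoc
  rw [zigzag_reassoc] at this
  simpa [← Algebra.TensorProduct.one_def] using this

theorem coactTwo_mul (q v : H ⊗[k] H) (r : H) :
    Q.coactTwo q v * (r ⊗ₜ 1) = Q.coactTwo (q * (r ⊗ₜ 1)) v := by
  induction v with
  | zero => simp
  | add x y hx hy => simp only [add_mul, map_add, hx, hy]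
  | tmul a b => simp [mul_assoc]

theorem coactTwo_comulEv (z : H ⊗[k] (H ⊗[k] H)) (w : H ⊗[k] H) :
    Q.coactTwo (Q.comulEv z) w = Q.comulEv (z * (1 ⊗ₜ w)) := by
  induction w with
  | zero => simp
  | add x y hx hy => simp only [tmul_add, mul_add, map_add, hx, hy]
  | tmul a b =>
    induction z using induction_three with
    | zero => simp
    | add x y hx hy =>
      rw [coactTwo_tmul] at *
      simp only [add_mul, mul_add, map_add, hx, hy]
    | tmul x y z => simp [mul_assoc, sinv_mul]

theorem twist_mul_sinv_alphaInv (c : H) :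
    Q.twist * ((Q.sinv c * Q.alphaInv) ⊗ₜ 1) =
      Q.comulEv (Q.reassocInv * (1 ⊗ₜ Q.comul c)) := by
  have e : (Q.sinv c * Q.alphaInv) ⊗ₜ[k] (1 : H) = (Q.sinv c ⊗ₜ 1) * (Q.alphaInv ⊗ₜ 1) := by
    simp
  rw [e, ← mul_assoc, ← coactTwo_twist, coactTwo_mul, twist_mul_alphaInv, coactTwo_comulEv]

theorem comulLeft_tmul_one (r : H) : Q.comulLeft (r ⊗ₜ 1) = appendTwo k H (Q.comul r) := by
  rw [comulLeft_tmul]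
  induction Q.comul r with
  | zero => simp
  | add x y hx hy => simp only [add_tmul, map_add, hx, hy]
  | tmul a b => simp

theorem comulLeft_one_tmul (r : H) : Q.comulLeft (1 ⊗ₜ r) = 1 ⊗ₜ (1 ⊗ₜ r) := by
  rw [comulLeft_tmul, map_one, Algebra.TensorProduct.one_def]; simp

theorem commute_appendTwo (b : H) (q : H ⊗[k] H) :
    appendTwo k H q * (1 ⊗ₜ (1 ⊗ₜ b)) = (1 ⊗ₜ (1 ⊗ₜ b)) * appendTwo k H q := by
  induction q with
  | zero => simp
  | add x y hx hy => simp only [add_mul, mul_add, map_add, hx, hy]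
  | tmul a b => simp

theorem coactThree_twist_tmul (a : H) (w : H ⊗[k] H) :
    Q.coactThree (Q.comulLeft Q.twist * appendTwo k H Q.twist) (a ⊗ₜ w) =
      Q.comulLeft (Q.coactTwo Q.twist w) * appendTwo k H (Q.twist * (1 ⊗ₜ a)) := by
  induction w with
  | zero => simp
  | add x y hx hy => simp only [tmul_add, add_mul, map_add, hx, hy]
  | tmul b c =>
    have e : (1 : H) ⊗ₜ[k] (a ⊗ₜ[k] b) = (1 ⊗ₜ (1 ⊗ₜ b)) * (1 ⊗ₜ (a ⊗ₜ 1)) := by simp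
    simp only [coactThree_tmul, coactTwo_tmul, map_mul, comulLeft_one_tmul, mul_assoc,
      appendTwo_tmul]
    rw [e, ← mul_assoc (appendTwo k H _), commute_appendTwo, mul_assoc]

theorem coactThree_twist_comulRight (v : H ⊗[k] H) :
    Q.coactThree (Q.comulLeft Q.twist * appendTwo k H Q.twist) (Q.comulRight v) =
      Q.comulLeft Q.twist * appendTwo k H (Q.coactTwo Q.twist v) := by
  induction v with
  | zero => simp
  | add x y hx hy => simp only [mul_add, map_add, hx, hy]
  | tmul a b =>
    rw [comulRight_tmul, coactThree_twist_tmul, coactTwo_twist, map_mul, comulLeft_tmul_one,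
      mul_assoc, ← map_mul, coactTwo_tmul, mul_assoc]

/-- The intertwining property of `twist` is used twice, once for each copy of it. -/
theorem coactThree_twist_comul (h : H) :
    Q.coactThree (Q.comulLeft Q.twist * appendTwo k H Q.twist)
      (Q.comulRight (Q.comul h)) =
      Q.comulLeft Q.twist * appendTwo k H Q.twist * (Q.sinv h ⊗ₜ 1) := by
  rw [coactThree_twist_comulRight, coactTwo_twist, map_mul, mul_assoc]; rfl

/-- `a ⊗ b ⊗ c ⊗ d ↦ (Δ ⊗ id)(Δ(S⁻¹(d) S⁻¹(α))) (a ⊗ b ⊗ c)` -/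
def comulEvFour : H ⊗[k] (H ⊗[k] (H ⊗[k] H)) →ₗ[k] H ⊗[k] (H ⊗[k] H) :=
  lift (LinearMap.mk₂ k (fun a y =>
      (lift (LinearMap.mk₂ k
        (fun d c => Q.comulLeft (Q.comul (Q.sinv c * Q.alphaInv)) * (1 ⊗ₜ d))
        (by intros; simp [mul_add, tmul_add])
        (by intros; rw [tmul_smul, mul_smul_comm])
        (by intros; simp [add_mul]) (by intros; simp)) ∘ₗ
        (TensorProduct.assoc k H H H).symm.toLinearMap) y * (a ⊗ₜ 1))
    (by intros; simp [mul_add, add_tmul])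
    (by intros; rw [← smul_tmul', mul_smul_comm])
    (by intros; simp [add_mul]) (by intros; simp))

theorem comulEvFour_tmul (a b c d : H) : Q.comulEvFour (a ⊗ₜ (b ⊗ₜ (c ⊗ₜ d))) =
    Q.comulLeft (Q.comul (Q.sinv d * Q.alphaInv)) * (a ⊗ₜ (b ⊗ₜ c)) := by
  change Q.comulLeft (Q.comul (Q.sinv d * Q.alphaInv)) * (1 ⊗ₜ (b ⊗ₜ c)) * (a ⊗ₜ 1) = _
  rw [mul_assoc]; simp

theorem comulEvFour_assoc (d : H ⊗[k] H) (m n : H) :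
    Q.comulEvFour (TensorProduct.assoc k H H (H ⊗[k] H) (d ⊗ₜ (m ⊗ₜ n))) =
      Q.comulLeft (Q.comul (Q.sinv n * Q.alphaInv)) *
        TensorProduct.assoc k H H H (d ⊗ₜ m) := by
  induction d with
  | zero => simp
  | add x y hx hy => simp only [add_tmul, mul_add, map_add, hx, hy]
  | tmul x y => simp [comulEvFour_tmul]

theorem comulEvFour_append_mul (z : H ⊗[k] (H ⊗[k] H)) (a n : H) (d : H ⊗[k] H) :
    Q.comulEvFour (appendThree k H z * (a ⊗ₜ TensorProduct.assoc k H H H (d ⊗ₜ n))) =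
      Q.comulLeft (Q.comul (Q.sinv n * Q.alphaInv)) * (z * (a ⊗ₜ d)) := by
  induction d with
  | zero => simp
  | add x y hx hy => simp only [add_tmul, tmul_add, mul_add, map_add, hx, hy]
  | tmul x y =>
    induction z using induction_three with
    | zero => simp
    | add x y hx hy => simp only [add_mul, mul_add, map_add, hx, hy]
    | tmul x y z => simp [comulEvFour_tmul]

theorem comulLeft_comulEv_mul (z : H ⊗[k] (H ⊗[k] H)) (a b : H) (w : H ⊗[k] H) :
    Q.comulLeft (Q.comulEv (z * (1 ⊗ₜ w))) * (a ⊗ₜ (b ⊗ₜ 1)) =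
      Q.comulEvFour (Q.comulFst z * (a ⊗ₜ (b ⊗ₜ w))) := by
  induction w with
  | zero => simp
  | add x y hx hy => simp only [tmul_add, mul_add, add_mul, map_add, hx, hy]
  | tmul u v =>
    induction z using induction_three with
    | zero => simp
    | add x y hx hy => simp only [add_mul, map_add, hx, hy]
    | tmul x y z =>
      rw [comulFst_tmul, assoc_mul_tmul_tmul, Algebra.TensorProduct.tmul_mul_tmul,
        Algebra.TensorProduct.tmul_mul_tmul, comulEvFour_assoc, comulEv_tmul, map_mul,
        comulLeft_tmul, mul_assoc, assoc_mul_tmul]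
      simp

theorem comulLeft_twist_mul_append_comulEv (x : H ⊗[k] (H ⊗[k] H)) :
    Q.comulLeft Q.twist * appendTwo k H (Q.comulEv x) =
      Q.comulEvFour (Q.comulFst Q.reassocInv * Q.comulTrd x) := by
  induction x using induction_three with
  | zero => simp
  | add x y hx hy => simp only [mul_add, map_add, hx, hy]
  | tmul a b c =>
    rw [comulTrd_tmul, comulRight_tmul, ← comulLeft_comulEv_mul, ← twist_mul_sinv_alphaInv,
      map_mul, comulLeft_tmul_one, comulEv_tmul, map_mul, mul_assoc]; rfl

/-- `a ⊗ b ⊗ c ↦ (id ⊗ Δ)(Δ(S⁻¹(c)) q) (1 ⊗ a ⊗ b)` -/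
def twistThree (q : H ⊗[k] H) : H ⊗[k] (H ⊗[k] H) →ₗ[k] H ⊗[k] (H ⊗[k] H) :=
  lift (LinearMap.mk₂ k (fun d c => Q.comulRight (Q.comul (Q.sinv c) * q) * (1 ⊗ₜ d))
    (by intros; simp [mul_add, tmul_add])
    (by intros; rw [tmul_smul, mul_smul_comm])
    (by intros; simp [add_mul]) (by intros; simp)) ∘ₗ
  (TensorProduct.assoc k H H H).symm.toLinearMap

theorem twistThree_tmul (q : H ⊗[k] H) (a b c : H) : Q.twistThree q (a ⊗ₜ (b ⊗ₜ c)) =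
    Q.comulRight (Q.comul (Q.sinv c) * q) * (1 ⊗ₜ (a ⊗ₜ b)) := rfl

theorem twistThree_assoc (q d : H ⊗[k] H) (c : H) :
    Q.twistThree q (TensorProduct.assoc k H H H (d ⊗ₜ c)) =
    Q.comulRight (Q.comul (Q.sinv c) * q) * (1 ⊗ₜ d) := by
  simp [twistThree]

theorem twistThree_mul (q : H ⊗[k] H) (y : H ⊗[k] (H ⊗[k] H)) (r : H) :
    Q.twistThree q y * (r ⊗ₜ 1) = Q.twistThree (q * (r ⊗ₜ 1)) y := by
  induction y using induction_three with
  | zero => simp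
  | add x y hx hy => simp only [add_mul, map_add, hx, hy]
  | tmul a b c => simp [twistThree_tmul, mul_assoc]

/-- The leading `Φ⁻¹` converts `(Δ ⊗ id)Δ` into `(id ⊗ Δ)Δ`, the form in which `twistThree` absorbs
a factor. -/
theorem coactThree_reassocInv_mul (q : H ⊗[k] H) (y v : H ⊗[k] (H ⊗[k] H)) :
    Q.coactThree (Q.reassocInv * Q.twistThree q y) v =
      Q.reassocInv * Q.twistThree q (y * v) := by
  induction v using induction_three with
  | zero => simp
  | add x y hx hy => simp only [mul_add, map_add, hx, hy]
  | tmul a b c =>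
    rw [coactThree_tmul, mul_assoc, ← mul_assoc, ← reassocInv_mul_comulRight_comul, mul_assoc]
    congr 1
    induction y using induction_three with
    | zero => simp
    | add x y hx hy => simp only [add_mul, mul_add, map_add, hx, hy]
    | tmul x y z => simp [twistThree_tmul, mul_assoc, sinv_mul]

theorem twistThree_comulLeft_mul (q v : H ⊗[k] H) (y : H ⊗[k] (H ⊗[k] H)) :
    Q.twistThree q (Q.comulLeft v * y) = Q.twistThree (Q.coactTwo q v) y := by
  induction y using induction_three with
  | zero => simp
  | add x y hx hy => simp only [mul_add, map_add, hx, hy]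
  | tmul x y z =>
    induction v with
    | zero => simp [twistThree_tmul]
    | add x y hx hy =>
      rw [twistThree_tmul] at *
      simp only [add_mul, mul_add, map_add, hx, hy]
    | tmul a b =>
      rw [comulLeft_tmul, assoc_mul_tmul, twistThree_assoc, twistThree_tmul, coactTwo_tmul]
      simp [mul_assoc, sinv_mul]

theorem coactThree_twistThree_comul (h : H) :
    Q.coactThree (Q.reassocInv * Q.twistThree Q.twist Q.reassocInv)
      (Q.comulRight (Q.comul h)) =
      Q.reassocInv * Q.twistThree Q.twist Q.reassocInv * (Q.sinv h ⊗ₜ 1) := by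
  rw [coactThree_reassocInv_mul, reassocInv_mul_comulRight_comul, twistThree_comulLeft_mul,
    coactTwo_twist, mul_assoc, twistThree_mul]

theorem reassocInv_mul_twistThree_comulEv (x y : H ⊗[k] (H ⊗[k] H)) :
    Q.reassocInv * Q.twistThree (Q.comulEv x) y =
      Q.comulEvFour (appendThree k H Q.reassocInv * Q.comulSnd x * (1 ⊗ₜ y)) := by
  induction y using induction_three with
  | zero => simp
  | add x y hx hy => simp only [tmul_add, mul_add, map_add, hx, hy]
  | tmul p q r =>
    induction x using induction_three with
    | zero => simp [twistThree_tmul]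
    | add x y hx hy =>
      rw [twistThree_tmul] at *
      simp only [add_mul, mul_add, map_add, hx, hy]
    | tmul a b c =>
      rw [comulSnd_tmul, mul_assoc, Algebra.TensorProduct.tmul_mul_tmul, mul_one,
        comulLeft_tmul, assoc_mul_tmul, comulEvFour_append_mul, ← mul_assoc,
        ← reassocInv_mul_comulRight_comul, mul_assoc, twistThree_tmul, comulEv_tmul]
      simp [mul_assoc, sinv_mul]

/-- Both sides are intertwiners, so by `eq_of_coactThree` they may be compared after multiplication
by `S⁻¹(α) ⊗ 1`. There `twist_mul_alphaInv` turns them into `comulEvFour` of the two sides of the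
inverted pentagon. -/
theorem comulLeft_twist_mul_append :
    Q.comulLeft Q.twist * appendTwo k H Q.twist =
      Q.reassocInv * Q.twistThree Q.twist Q.reassocInv := by
  refine Q.eq_of_coactThree Q.coactThree_twist_comul Q.coactThree_twistThree_comul ?_
  rw [mul_assoc, mul_assoc, twistThree_mul, twist_mul_alphaInv,
    reassocInv_mul_twistThree_comulEv, append_comulSnd_inv,
    ← comulLeft_twist_mul_append_comulEv, ← twist_mul_alphaInv, map_mul]
  rfl

/-- `id ⊗ ε : H ⊗ H → H` -/
def counitRight : H ⊗[k] H →ₐ[k] H :=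
  (Algebra.TensorProduct.rid k k H).toAlgHom.comp
    (Algebra.TensorProduct.map (AlgHom.id k H) Q.counit)

@[simp] theorem counitRight_tmul (a b : H) :
    Q.counitRight (a ⊗ₜ b) = Q.counit b • a := rfl

theorem counitRight_comul (h : H) : Q.counitRight (Q.comul h) = h := by
  change Algebra.TensorProduct.rid k k H (Algebra.TensorProduct.map _ _ (Q.comul h)) = h
  rw [Q.id_counit_comul]; simp

theorem counitRight_pL : Q.counitRight Q.pL = Q.betaInv := by
  have := Q.eq_of_counit_trd Q.counit_trd
    (Q.counitRight.toLinearMap ∘ₗ Q.coevThree) (fun a b c => by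
      change Q.counitRight (Q.coevThree (a ⊗ₜ (b ⊗ₜ c))) =
        Q.counit c • Q.counitRight (Q.coevThree (a ⊗ₜ (b ⊗ₜ 1)))
      simp [coevThree_tmul])
  refine this.trans ?_
  change Q.counitRight (Q.coevThree (1 ⊗ₜ (1 ⊗ₜ 1))) = _
  simp [coevThree_tmul, sinv_one]

/-- Under `id ⊗ ε` the coproducts disappear and `pL` becomes `S⁻¹(β)`, so the antipode axiom for `Φ`
remains. -/
theorem counitRight_twist : Q.counitRight Q.twist = 1 := by
  have h : ∀ w, Q.counitRight (Q.preTwist w) = Q.zigzag w := by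
    intro w
    induction w using induction_three with
    | zero => simp
    | add x y hx hy => simp only [map_add, hx, hy]
    | tmul a b c => rw [preTwist_tmul, map_mul, map_mul, counitRight_comul, counitRight_pL]; simp
  rw [twist, h, zigzag_reassoc]

/-! ### The representation of the crossed product on `H ⊗ H`. -/

/-- `a ⊗ b ⊗ c ↦ φ(c) a ⊗ b` -/
def evalTrd (φ : Module.Dual k H) : H ⊗[k] (H ⊗[k] H) →ₗ[k] H ⊗[k] H :=
  LinearMap.lTensor H ((TensorProduct.rid k H).toLinearMap ∘ₗ LinearMap.lTensor H φ)

@[simp] theorem evalTrd_tmul (φ : Module.Dual k H) (a b c : H) :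
    evalTrd φ (a ⊗ₜ (b ⊗ₜ c)) = φ c • (a ⊗ₜ b) := by
  simp [evalTrd]

theorem evalTrd_add (φ ψ : Module.Dual k H) (w : H ⊗[k] (H ⊗[k] H)) :
    evalTrd (φ + ψ) w = evalTrd φ w + evalTrd ψ w := by
  induction w using induction_three with
  | zero => simp
  | add x y hx hy => simp only [map_add, hx, hy]; abel
  | tmul a b c => simp [add_smul]

theorem evalTrd_smul (r : k) (φ : Module.Dual k H) (w : H ⊗[k] (H ⊗[k] H)) :
    evalTrd (r • φ) w = r • evalTrd φ w := by
  induction w using induction_three with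
  | zero => simp
  | add x y hx hy => simp only [map_add, smul_add, hx, hy]
  | tmul a b c => simp [mul_smul]

theorem evalTrd_mul_one_tmul (φ : Module.Dual k H) (w : H ⊗[k] (H ⊗[k] H)) (c : H) :
    evalTrd φ (w * (1 ⊗ₜ (1 ⊗ₜ c))) = evalTrd (regL k H c φ) w := by
  induction w using induction_three with
  | zero => simp
  | add x y hx hy => simp only [add_mul, map_add, hx, hy]
  | tmul x y z => simp

theorem evalTrd_mul (φ : Module.Dual k H) (w : H ⊗[k] (H ⊗[k] H)) (r : H) :
    evalTrd φ w * (1 ⊗ₜ r) = evalTrd φ (w * (1 ⊗ₜ (r ⊗ₜ 1))) := by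
  induction w using induction_three with
  | zero => simp
  | add x y hx hy => simp only [add_mul, map_add, hx, hy]
  | tmul x y z => simp

theorem evalTrd_comulLeft_mul (φ : Module.Dual k H) (w : H ⊗[k] (H ⊗[k] H)) (a b : H) :
    evalTrd φ (Q.comulLeft (a ⊗ₜ b) * w) = Q.comul a * evalTrd (regR k H b φ) w := by
  induction w using induction_three with
  | zero => simp
  | add x y hx hy => simp only [mul_add, map_add, hx, hy]
  | tmul x y z =>
    rw [comulLeft_tmul, assoc_mul_tmul]
    have : ∀ d : H ⊗[k] H, ∀ c, evalTrd φ (TensorProduct.assoc k H H H (d ⊗ₜ c)) = φ c • d := by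
      intro d c
      induction d with
      | zero => simp
      | add x y hx hy => simp only [add_tmul, map_add, hx, hy, smul_add]
      | tmul x y => simp
    simp [this]

/-- The quasi-coaction of `H` on `H ⊗ H`. -/
def coaction : H ⊗[k] H →ₗ[k] H ⊗[k] (H ⊗[k] H) :=
  LinearMap.mulLeft k Q.reassocInv ∘ₗ Q.comulRight.toLinearMap

theorem coaction_apply (m : H ⊗[k] H) : Q.coaction m = Q.reassocInv * Q.comulRight m := rfl

theorem coaction_mul (m n : H ⊗[k] H) : Q.coaction (m * n) = Q.coaction m * Q.comulRight n := by
  simp [coaction_apply, mul_assoc]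

theorem coaction_comul_mul (h : H) (m : H ⊗[k] H) :
    Q.coaction (Q.comul h * m) = Q.comulLeft (Q.comul h) * Q.coaction m := by
  rw [coaction_apply, coaction_apply, map_mul, ← mul_assoc, reassocInv_mul_comulRight_comul,
    mul_assoc]

/-- The action of `H*` on `H ⊗ H`. -/
def actDual : Module.Dual k H →ₗ[k] Module.End k (H ⊗[k] H) where
  toFun φ := evalTrd φ ∘ₗ LinearMap.mulRight k (1 ⊗ₜ Q.twist) ∘ₗ Q.coaction
  map_add' φ ψ := LinearMap.ext fun _ => evalTrd_add φ ψ _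
  map_smul' r φ := LinearMap.ext fun _ => evalTrd_smul r φ _

theorem actDual_apply (φ : Module.Dual k H) (m : H ⊗[k] H) :
    Q.actDual φ m = evalTrd φ (Q.coaction m * (1 ⊗ₜ Q.twist)) := rfl

/-- The action of the left tensor factor `H` on `H ⊗ H`. -/
def actLeft : H →ₐ[k] Module.End k (H ⊗[k] H) := (Algebra.lmul k (H ⊗[k] H)).comp Q.comul

theorem actLeft_apply (h : H) (m : H ⊗[k] H) : Q.actLeft h m = Q.comul h * m := rfl

/-- The action of the right tensor factor `H` on `H ⊗ H`. -/
def actRight : H →ₗ[k] Module.End k (H ⊗[k] H) :=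
  (LinearMap.mul k (H ⊗[k] H)).flip ∘ₗ TensorProduct.mk k H H 1 ∘ₗ Q.sinv

theorem actRight_apply (l : H) (m : H ⊗[k] H) :
    Q.actRight l m = m * (1 ⊗ₜ Q.sinv l) := rfl

theorem actRight_mul (a b : H) : Q.actRight (a * b) = Q.actRight a * Q.actRight b := by
  refine LinearMap.ext fun m => ?_
  rw [Module.End.mul_apply]
  simp [actRight_apply, sinv_mul, mul_assoc]

theorem actRight_one : Q.actRight 1 = 1 := by
  refine LinearMap.ext fun m => ?_
  simp [actRight_apply, sinv_one, ← Algebra.TensorProduct.one_def]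

theorem actRight_mul_actLeft (l h : H) :
    Q.actRight l * Q.actLeft h = Q.actLeft h * Q.actRight l := by
  refine LinearMap.ext fun m => ?_
  simp [actRight_apply, actLeft_apply, mul_assoc]

/-- The straightening relation responsible for `h'₁` and `h'₂` in the product; it expresses that `ρ`
is compatible with left multiplication by `Δ(h)`. -/
theorem actDual_mul_actLeft {ι : Type*} (s : Finset ι) (a b : ι → H) (h : H)
    (hh : Q.comul h = ∑ i ∈ s, a i ⊗ₜ[k] b i) (φ : Module.Dual k H) :
    Q.actDual φ * Q.actLeft h = ∑ i ∈ s, Q.actLeft (a i) * Q.actDual (regR k H (b i) φ) := by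
  refine LinearMap.ext fun m => ?_
  rw [Module.End.mul_apply, actLeft_apply, actDual_apply, coaction_comul_mul, hh, map_sum,
    Finset.sum_mul, Finset.sum_mul, map_sum, LinearMap.sum_apply]
  refine Finset.sum_congr rfl fun i _ => ?_
  rw [mul_assoc, evalTrd_comulLeft_mul]; rfl

/-- The relation responsible for `l₁` and `l₂`; it is the intertwining property of `twist` read
inside the definition of the operator of `φ`. -/
theorem actRight_mul_actDual {ι : Type*} (s : Finset ι) (a b : ι → H) (h : H)
    (hh : Q.comul h = ∑ i ∈ s, a i ⊗ₜ[k] b i) (φ : Module.Dual k H) :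
    Q.actRight h * Q.actDual φ = ∑ i ∈ s, Q.actDual (regL k H (a i) φ) * Q.actRight (b i) := by
  refine LinearMap.ext fun m => ?_
  have e : (1 : H) ⊗ₜ[k] Q.twist * (1 ⊗ₜ (Q.sinv h ⊗ₜ 1)) =
      ∑ i ∈ s, 1 ⊗ₜ (Q.comul (Q.sinv (b i)) * Q.twist * (1 ⊗ₜ a i)) := by
    rw [Algebra.TensorProduct.tmul_mul_tmul, ← coactTwo_twist, hh, map_sum, tmul_sum, one_mul]
    rfl
  rw [Module.End.mul_apply, actRight_apply, actDual_apply, evalTrd_mul, mul_assoc, e,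
    Finset.mul_sum, map_sum, LinearMap.sum_apply]
  refine Finset.sum_congr rfl fun i _ => ?_
  rw [Module.End.mul_apply, actRight_apply, actDual_apply, coaction_mul, comulRight_tmul,
    ← evalTrd_mul_one_tmul]
  simp only [mul_assoc, Algebra.TensorProduct.tmul_mul_tmul, one_mul]

theorem actDual_counit : Q.actDual Q.counit.toLinearMap = 1 := by
  refine LinearMap.ext fun m => ?_
  have h : ∀ w, evalTrd Q.counit.toLinearMap w =
      Algebra.TensorProduct.map (AlgHom.id k H) Q.counitRight w := by
    intro w
    induction w using induction_three with
    | zero => simp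
    | add x y hx hy => simp only [map_add, hx, hy]
    | tmul a b c => simp
  have h1 : Algebra.TensorProduct.map (AlgHom.id k H) Q.counitRight Q.reassocInv = 1 := by
    have : ∀ w : H ⊗[k] (H ⊗[k] H), Algebra.TensorProduct.map (AlgHom.id k H) Q.counitRight w =
      Algebra.TensorProduct.map (AlgHom.id k H) (Algebra.TensorProduct.rid k k H).toAlgHom
        (Algebra.TensorProduct.map (AlgHom.id k H)
          (Algebra.TensorProduct.map (AlgHom.id k H) Q.counit) w) := by
      intro w
      induction w using induction_three with
      | zero => simp
      | add x y hx hy => simp only [map_add, hx, hy]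
      | tmul a b c => simp
    rw [this, counit_trd_inv, map_one]
  have h2 : Algebra.TensorProduct.map (AlgHom.id k H) Q.counitRight (Q.comulRight m) = m := by
    induction m with
    | zero => simp
    | add x y hx hy => simp only [map_add, hx, hy]
    | tmul a b => simp [counitRight_comul]
  rw [actDual_apply, h, coaction_apply, map_mul, map_mul, h1, h2]
  simp [counitRight_twist, ← Algebra.TensorProduct.one_def]

/-- `a ⊗ b ⊗ c ⊗ d ↦ φ(c) ψ(d) a ⊗ b` -/
def evalTrdFth (φ ψ : Module.Dual k H) : H ⊗[k] (H ⊗[k] (H ⊗[k] H)) →ₗ[k] H ⊗[k] H :=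
  evalTrd φ ∘ₗ LinearMap.lTensor H (evalTrd ψ)

@[simp] theorem evalTrdFth_tmul (φ ψ : Module.Dual k H) (a b c d : H) :
    evalTrdFth φ ψ (a ⊗ₜ (b ⊗ₜ (c ⊗ₜ d))) = (ψ d * φ c) • (a ⊗ₜ b) := by
  simp [evalTrdFth, mul_smul]

theorem evalTrdFth_comulFst_mul (φ ψ : Module.Dual k H) (a b c : H)
    (u : H ⊗[k] (H ⊗[k] (H ⊗[k] H))) :
    evalTrdFth φ ψ (Q.comulFst (a ⊗ₜ (b ⊗ₜ c)) * u) =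
      Q.comul a * evalTrdFth (regR k H b φ) (regR k H c ψ) u := by
  induction u using induction_four with
  | zero => simp
  | add x y hx hy => simp only [mul_add, map_add, hx, hy]
  | tmul p q r s =>
    rw [comulFst_tmul, assoc_mul_tmul_tmul]
    have : ∀ d : H ⊗[k] H, ∀ m n, evalTrdFth φ ψ
        (TensorProduct.assoc k H H (H ⊗[k] H) (d ⊗ₜ (m ⊗ₜ n))) = (ψ n * φ m) • d := by
      intro d m n
      induction d with
      | zero => simp
      | add x y hx hy => simp only [add_tmul, map_add, hx, hy, smul_add]
      | tmul x y => simp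
    simp [this]

theorem evalTrdFth_mul_one_tmul (φ ψ : Module.Dual k H) (b c : H)
    (u : H ⊗[k] (H ⊗[k] (H ⊗[k] H))) :
    evalTrdFth φ ψ (u * (1 ⊗ₜ (1 ⊗ₜ (b ⊗ₜ c)))) =
      evalTrdFth (regL k H b φ) (regL k H c ψ) u := by
  induction u using induction_four with
  | zero => simp
  | add x y hx hy => simp only [add_mul, map_add, hx, hy]
  | tmul p q r s => simp

theorem evalTrdFth_comulTrd (φ ψ : Module.Dual k H) (w : H ⊗[k] (H ⊗[k] H)) :
    evalTrdFth φ ψ (Q.comulTrd w) = evalTrd (Q.conv φ ψ) w := by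
  induction w using induction_three with
  | zero => simp
  | add x y hx hy => simp only [map_add, hx, hy]
  | tmul a b c =>
    rw [comulTrd_tmul, comulRight_tmul, evalTrd_tmul, conv_apply]
    induction Q.comul c with
    | zero => simp
    | add x y hx hy => simp only [tmul_add, map_add, hx, hy, add_smul]
    | tmul x y => simp [mul_comm]

theorem lTensor_evalTrd_append (ψ : Module.Dual k H) (y z : H ⊗[k] (H ⊗[k] H))
    (u : H ⊗[k] (H ⊗[k] (H ⊗[k] H))) :
    LinearMap.lTensor H (evalTrd ψ) (appendThree k H y * u * appendThree k H z) =
      y * LinearMap.lTensor H (evalTrd ψ) u * z := by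
  induction u using induction_four with
  | zero => simp
  | add x y hx hy => simp only [mul_add, add_mul, map_add, hx, hy]
  | tmul p q r s =>
    induction y using induction_three with
    | zero => simp
    | add x y hx hy => simp only [add_mul, map_add, hx, hy]
    | tmul a b c =>
      induction z using induction_three with
      | zero => simp
      | add x y hx hy => simp only [mul_add, map_add, hx, hy]
      | tmul a b c => simp

theorem lTensor_evalTrd_comulSnd (ψ : Module.Dual k H) (w : H ⊗[k] (H ⊗[k] H)) :
    LinearMap.lTensor H (evalTrd ψ) (Q.comulSnd w) = Q.comulRight (evalTrd ψ w) := by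
  induction w using induction_three with
  | zero => simp
  | add x y hx hy => simp only [map_add, hx, hy]
  | tmul a b c =>
    rw [comulSnd_tmul, comulLeft_tmul, evalTrd_tmul, map_smul, comulRight_tmul]
    induction Q.comul b with
    | zero => simp
    | add x y hx hy => simp only [add_tmul, tmul_add, map_add, hx, hy, smul_add]
    | tmul x y => simp

theorem comulSnd_comulRight_mul (m : H ⊗[k] H) :
    Q.comulSnd (Q.comulRight m) * (1 ⊗ₜ Q.reassocInv) =
      (1 ⊗ₜ Q.reassocInv) * Q.comulTrd (Q.comulRight m) := by
  induction m with
  | zero => simp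
  | add x y hx hy => simp only [add_mul, mul_add, map_add, hx, hy]
  | tmul a b => simp [reassocInv_mul_comulRight_comul]

/-- Composing two operators of `H*` iterates `ρ` and produces two copies of `twist`. The cocycle
identity merges these, and the `Φ⁻¹` it releases completes the inverted pentagon, so that `ρ(m)`
occurs only once. -/
theorem actDual_mul_apply (φ ψ : Module.Dual k H) (m : H ⊗[k] H) :
    (Q.actDual φ * Q.actDual ψ) m = evalTrdFth φ ψ (Q.comulFst Q.reassocInv *
      (Q.comulTrd (Q.coaction m) * (1 ⊗ₜ Q.twistThree Q.twist Q.reassocInv))) := by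
  have e1 : Q.comulSnd (1 ⊗ₜ Q.twist) * appendThree k H (1 ⊗ₜ Q.twist) =
      (1 ⊗ₜ Q.reassocInv) * (1 ⊗ₜ Q.twistThree Q.twist Q.reassocInv) := by
    rw [comulSnd_tmul, appendThree_tmul, Algebra.TensorProduct.tmul_mul_tmul,
      comulLeft_twist_mul_append, Algebra.TensorProduct.tmul_mul_tmul]
  rw [Module.End.mul_apply, actDual_apply, actDual_apply, coaction_apply,
    ← lTensor_evalTrd_comulSnd, ← lTensor_evalTrd_append]
  change evalTrdFth φ ψ _ = _
  congr 1
  rw [map_mul, mul_assoc, mul_assoc, e1, ← mul_assoc (Q.comulSnd _), coaction_apply, map_mul,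
    mul_assoc (Q.comulSnd _), comulSnd_comulRight_mul, map_mul, ← mul_assoc, ← mul_assoc,
    ← mul_assoc, append_comulSnd_inv]
  simp only [mul_assoc]

theorem actDual_mul_actDual {τ : Type*} (r : Finset τ) (x₁ x₂ x₃ : τ → H)
    (hx : Q.reassocInv = ∑ p ∈ r, x₁ p ⊗ₜ[k] (x₂ p ⊗ₜ[k] x₃ p)) (φ ψ : Module.Dual k H) :
    Q.actDual φ * Q.actDual ψ = ∑ p ∈ r, ∑ q ∈ r, Q.actLeft (x₁ p) *
      (Q.actDual (Q.conv (regL k H (x₁ q) (regR k H (x₂ p) φ))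
        (regL k H (x₂ q) (regR k H (x₃ p) ψ))) * Q.actRight (x₃ q)) := by
  refine LinearMap.ext fun m => ?_
  rw [actDual_mul_apply]
  have e1 : Q.comulFst Q.reassocInv =
      ∑ p ∈ r, Q.comulFst (x₁ p ⊗ₜ[k] (x₂ p ⊗ₜ[k] x₃ p)) := by
    rw [hx, map_sum]
  have e2 : (1 : H) ⊗ₜ[k] Q.twistThree Q.twist Q.reassocInv = ∑ q ∈ r,
      (1 : H) ⊗ₜ[k] Q.twistThree Q.twist (x₁ q ⊗ₜ[k] (x₂ q ⊗ₜ[k] x₃ q)) := by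
    rw [hx, map_sum, tmul_sum]
  rw [e1, e2, Finset.sum_mul, map_sum, LinearMap.sum_apply]
  refine Finset.sum_congr rfl fun p _ => ?_
  rw [Finset.mul_sum, Finset.mul_sum, map_sum, LinearMap.sum_apply]
  refine Finset.sum_congr rfl fun q _ => ?_
  rw [evalTrdFth_comulFst_mul, twistThree_tmul, Module.End.mul_apply, Module.End.mul_apply,
    actLeft_apply, actRight_apply, actDual_apply, coaction_mul, ← evalTrdFth_comulTrd,
    ← evalTrdFth_mul_one_tmul]
  congr 2
  simp [mul_assoc]

/-- The action of the two-sided crossed product on `H ⊗ H`: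
`h ⊗ φ ⊗ l` acts as `h ∘ φ ∘ l`. -/
def act : H ⊗[k] (Module.Dual k H ⊗[k] H) →ₗ[k] Module.End k (H ⊗[k] H) :=
  LinearMap.mul' k _ ∘ₗ TensorProduct.map Q.actLeft.toLinearMap
    (LinearMap.mul' k _ ∘ₗ TensorProduct.map Q.actDual Q.actRight)

theorem act_tmul (h : H) (φ : Module.Dual k H) (l : H) :
    Q.act (h ⊗ₜ (φ ⊗ₜ l)) = Q.actLeft h * (Q.actDual φ * Q.actRight l) := rfl

theorem exists_sum_tmul_tmul (w : H ⊗[k] (H ⊗[k] H)) :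
    ∃ r : Finset ((_ : H × (H ⊗[k] H)) × (H × H)),
      w = ∑ p ∈ r, p.1.1 ⊗ₜ[k] (p.2.1 ⊗ₜ[k] p.2.2) := by
  obtain ⟨S, hS⟩ := TensorProduct.exists_finset w
  choose T hT using fun i : H × (H ⊗[k] H) => TensorProduct.exists_finset i.2
  refine ⟨S.sigma T, ?_⟩
  rw [Finset.sum_sigma, hS]
  refine Finset.sum_congr rfl fun i _ => ?_
  conv_lhs => rw [hT i, tmul_sum]

/-- The word `h φ l h' φ' l'` is straightened: `l` commutes with `h'`, then `φ` passes `h'`, `l`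
passes `φ'`, and the two adjacent functionals are multiplied by `actDual_mul_actDual`. The outcome
is the crossed multiplication term by term. -/
theorem act_crossedMul (x y : H ⊗[k] (Module.Dual k H ⊗[k] H)) :
    Q.act (Q.crossedMul x y) = Q.act x * Q.act y := by
  have key : ∀ (h h' l l' : H) (φ φ' : Module.Dual k H),
      Q.act (Q.crossedMul (h ⊗ₜ (φ ⊗ₜ l)) (h' ⊗ₜ (φ' ⊗ₜ l'))) =
        Q.act (h ⊗ₜ (φ ⊗ₜ l)) * Q.act (h' ⊗ₜ (φ' ⊗ₜ l')) := by
    intro h h' l l' φ φ'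
    obtain ⟨s, hs⟩ := TensorProduct.exists_finset (Q.comul h')
    obtain ⟨t, ht⟩ := TensorProduct.exists_finset (Q.comul l)
    obtain ⟨r, hr⟩ := exists_sum_tmul_tmul Q.reassocInv
    rw [Q.crossedMul_tmul s t r _ _ _ _ _ _ _ h h' l l' φ φ' hs ht hr]
    have e : Q.act (h ⊗ₜ (φ ⊗ₜ l)) * Q.act (h' ⊗ₜ (φ' ⊗ₜ l')) =
        Q.actLeft h * (Q.actDual φ * Q.actLeft h') *
          (Q.actRight l * Q.actDual φ') * Q.actRight l' := by
      rw [act_tmul, act_tmul]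
      simp only [mul_assoc]
      rw [← mul_assoc (Q.actRight l) (Q.actLeft h'), actRight_mul_actLeft]
      simp only [mul_assoc]
    rw [e, Q.actDual_mul_actLeft s _ _ h' hs, Q.actRight_mul_actDual t _ _ l ht]
    simp only [map_sum, Finset.mul_sum, Finset.sum_mul]
    have e2 : ∀ i j, Q.actLeft h * (Q.actLeft (Prod.fst i) *
          Q.actDual (regR k H (Prod.snd i) φ)) *
        (Q.actDual (regL k H (Prod.fst j) φ') * Q.actRight (Prod.snd j)) * Q.actRight l' =
        ∑ p ∈ r, ∑ q ∈ r, Q.act ((h * i.1 * p.1.1) ⊗ₜ[k]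
          (Q.conv (regL k H q.1.1 (regR k H (i.2 * p.2.1) φ))
              (regL k H (q.2.1 * j.1) (regR k H p.2.2 φ')) ⊗ₜ[k]
            (q.2.2 * j.2 * l'))) := by
      intro i j
      have : Q.actLeft h * (Q.actLeft (Prod.fst i) *
          Q.actDual (regR k H (Prod.snd i) φ)) *
        (Q.actDual (regL k H (Prod.fst j) φ') * Q.actRight (Prod.snd j)) * Q.actRight l' =
        Q.actLeft h * Q.actLeft (Prod.fst i) *
          (Q.actDual (regR k H (Prod.snd i) φ) * Q.actDual (regL k H (Prod.fst j) φ')) *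
            Q.actRight (Prod.snd j) * Q.actRight l' := by
        simp only [mul_assoc]
      rw [this, Q.actDual_mul_actDual r _ _ _ hr]
      simp only [Finset.mul_sum, Finset.sum_mul]
      refine Finset.sum_congr rfl fun p _ => Finset.sum_congr rfl fun q _ => ?_
      have r1 : regR k H (i.2 * p.2.1) φ = regR k H p.2.1 (regR k H i.2 φ) := by
        ext; simp [mul_assoc]
      have r2 : regL k H (q.2.1 * j.1) (regR k H p.2.2 φ') =
          regL k H q.2.1 (regR k H p.2.2 (regL k H j.1 φ')) := by
        ext; simp [mul_assoc]
      rw [act_tmul, r1, r2, map_mul, map_mul, actRight_mul, actRight_mul]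
      simp only [mul_assoc]
    simp only [e2]
    refine Eq.trans (Finset.sum_congr rfl fun i _ => ?_) Finset.sum_comm
    exact (Finset.sum_congr rfl fun p _ => Finset.sum_comm).trans Finset.sum_comm
  induction x with
  | zero => simp
  | add x y hx hy => simp only [map_add, LinearMap.add_apply, add_mul, hx, hy]
  | tmul h w =>
    induction w with
    | zero => simp
    | add x y hx hy => simp only [tmul_add, map_add, LinearMap.add_apply, add_mul, hx, hy]
    | tmul φ l =>
      induction y with
      | zero => simp
      | add x y hx hy => simp only [map_add, mul_add, hx, hy]
      | tmul h' w =>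
        induction w with
        | zero => simp
        | add x y hx hy => simp only [tmul_add, map_add, mul_add, hx, hy]
        | tmul φ' l' => exact key h h' l l' φ φ'

theorem act_crossedOne : Q.act Q.crossedOne = 1 := by
  rw [crossedOne, act_tmul, actDual_counit, actRight_one, map_one]; rfl

/-! ### Removing the twist from the operators in the image. -/

theorem mul_mem_range_act {x y : Module.End k (H ⊗[k] H)} (hx : x ∈ LinearMap.range Q.act)
    (hy : y ∈ LinearMap.range Q.act) : x * y ∈ LinearMap.range Q.act := by
  obtain ⟨a, rfl⟩ := hx
  obtain ⟨b, rfl⟩ := hy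
  exact ⟨_, Q.act_crossedMul a b⟩

theorem actLeft_mem_range_act (h : H) : Q.actLeft h ∈ LinearMap.range Q.act :=
  ⟨h ⊗ₜ (Q.counit.toLinearMap ⊗ₜ 1), by
    rw [act_tmul, actDual_counit, actRight_one, mul_one, mul_one]⟩

theorem actRight_mem_range_act (l : H) : Q.actRight l ∈ LinearMap.range Q.act :=
  ⟨1 ⊗ₜ (Q.counit.toLinearMap ⊗ₜ l), by
    rw [act_tmul, actDual_counit, map_one, one_mul, one_mul]⟩

theorem actDual_mem_range_act (φ : Module.Dual k H) : Q.actDual φ ∈ LinearMap.range Q.act :=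
  ⟨1 ⊗ₜ (φ ⊗ₜ 1), by rw [act_tmul, actRight_one, map_one, one_mul, mul_one]⟩

/-- The operator `m ↦ (id ⊗ id ⊗ φ)(ρ(m) (1 ⊗ t))`, where `ρ` is the quasi-coaction. -/
def actDualWith (φ : Module.Dual k H) : H ⊗[k] H →ₗ[k] Module.End k (H ⊗[k] H) :=
  LinearMap.mk₂ k (fun t m => evalTrd φ (Q.coaction m * (1 ⊗ₜ t)))
    (by intros; simp [tmul_add, mul_add])
    (by intros; rw [tmul_smul, mul_smul_comm, map_smul])
    (by intros; simp [add_mul])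
    (by intros; simp)

theorem actDualWith_apply (φ : Module.Dual k H) (t m : H ⊗[k] H) :
    Q.actDualWith φ t m = evalTrd φ (Q.coaction m * (1 ⊗ₜ t)) := rfl

/-- The elements `t` for which the operators `actDualWith φ t` are in the image of the crossed
product. -/
def admissible : Submodule k (H ⊗[k] H) :=
  ⨅ φ : Module.Dual k H, (LinearMap.range Q.act).comap (Q.actDualWith φ)

theorem mem_admissible {t : H ⊗[k] H} :
    t ∈ Q.admissible ↔ ∀ φ, Q.actDualWith φ t ∈ LinearMap.range Q.act := by
  simp [admissible]

theorem twist_mem_admissible : Q.twist ∈ Q.admissible :=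
  Q.mem_admissible.2 fun φ => Q.actDual_mem_range_act φ

/-- The factor `c` is absorbed into the functional, and `b` is right multiplication on the second
leg of the result, which is the action of `S(b)`. -/
theorem admissible_mul_tmul {t : H ⊗[k] H} (ht : t ∈ Q.admissible) (b c : H) :
    t * (b ⊗ₜ c) ∈ Q.admissible := by
  refine Q.mem_admissible.2 fun φ => ?_
  have : Q.actDualWith φ (t * (b ⊗ₜ c)) =
      Q.actRight (Q.S b) * Q.actDualWith (regL k H c φ) t := by
    refine LinearMap.ext fun m => ?_
    rw [Module.End.mul_apply, actRight_apply, actDualWith_apply, actDualWith_apply, evalTrd_mul,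
      ← evalTrd_mul_one_tmul, sinv_S]
    simp only [mul_assoc, Algebra.TensorProduct.tmul_mul_tmul, one_mul, mul_one]
  rw [this]
  exact Q.mul_mem_range_act (Q.actRight_mem_range_act _) (Q.mem_admissible.1 ht _)

theorem admissible_mul {t : H ⊗[k] H} (ht : t ∈ Q.admissible) (d : H ⊗[k] H) :
    t * d ∈ Q.admissible := by
  induction d with
  | zero => simp
  | add x y hx hy => rw [mul_add]; exact add_mem hx hy
  | tmul b c => exact Q.admissible_mul_tmul ht b c

theorem comul_mul_admissible {t : H ⊗[k] H} (ht : t ∈ Q.admissible) (l : H) :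
    Q.comul (Q.sinv l) * t ∈ Q.admissible := by
  refine Q.mem_admissible.2 fun φ => ?_
  have : Q.actDualWith φ (Q.comul (Q.sinv l) * t) = Q.actDualWith φ t * Q.actRight l := by
    refine LinearMap.ext fun m => ?_
    rw [Module.End.mul_apply, actRight_apply, actDualWith_apply, actDualWith_apply,
      coaction_mul, comulRight_tmul, mul_assoc, Algebra.TensorProduct.tmul_mul_tmul, one_mul]
  rw [this]
  exact Q.mul_mem_range_act (Q.mem_admissible.1 ht _) (Q.actRight_mem_range_act _)

theorem comulEv_mul_mem_admissible {z : H ⊗[k] (H ⊗[k] H)} (hz : Q.comulEv z ∈ Q.admissible)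
    (x : H ⊗[k] (H ⊗[k] H)) : Q.comulEv (z * x) ∈ Q.admissible := by
  induction x using induction_three with
  | zero => simp
  | add x y hx hy => rw [mul_add, map_add]; exact add_mem hx hy
  | tmul a b c =>
    have : Q.comulEv (z * (a ⊗ₜ (b ⊗ₜ c))) =
        Q.comul (Q.sinv c) * (Q.comulEv z * (a ⊗ₜ b)) := by
      clear hz
      induction z using induction_three with
      | zero => simp
      | add x y hx hy => simp only [add_mul, mul_add, map_add, hx, hy]
      | tmul x y z => simp [sinv_mul, mul_assoc]
    rw [this]
    exact Q.comul_mul_admissible (Q.admissible_mul hz _) _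

/-- This replaces inverting `twist`: from `twist` one reaches `Δ(S⁻¹(α))`, and from there `Δ` of the
zigzag of `Φ`, which is `1`. -/
theorem one_mem_admissible : (1 : H ⊗[k] H) ∈ Q.admissible := by
  have h1 : Q.comul Q.alphaInv ∈ Q.admissible := by
    -- `twist (S⁻¹(α) ⊗ 1) = comulEv Φ⁻¹` is admissible, and multiplying the argument by `Φ` cancels
    -- `Φ⁻¹`.
    have := Q.comulEv_mul_mem_admissible (z := Q.reassocInv)
      (by rw [← twist_mul_alphaInv]; exact Q.admissible_mul Q.twist_mem_admissible _) Q.reassoc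
    rw [reassoc_inv_mul] at this
    change Q.comulEv (1 ⊗ₜ (1 ⊗ₜ 1)) ∈ _ at this
    rwa [comulEv_tmul, sinv_one, one_mul, ← Algebra.TensorProduct.one_def, mul_one] at this
  have h2 : ∀ w, Q.comul (Q.zigzag w) ∈ Q.admissible := by
    intro w
    induction w using induction_three with
    | zero => simp
    | add x y hx hy => rw [map_add, map_add]; exact add_mem hx hy
    | tmul a b c =>
      rw [zigzag_tmul, ev_tmul, mul_assoc, mul_assoc, map_mul, map_mul]
      exact Q.comul_mul_admissible (Q.admissible_mul h1 _) _
  have := h2 Q.reassoc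
  rwa [zigzag_reassoc, map_one] at this

/-! ### Rebuilding the operators `id ⊗ f` inside the image. -/

/-- `a ⊗ b ⊗ c ↦ a ⊗ b t(c)` -/
def mulTrd (t : Module.End k H) : H ⊗[k] (H ⊗[k] H) →ₗ[k] H ⊗[k] H :=
  LinearMap.lTensor H (LinearMap.mul' k H ∘ₗ LinearMap.lTensor H t)

@[simp] theorem mulTrd_tmul (t : Module.End k H) (a b c : H) :
    mulTrd t (a ⊗ₜ (b ⊗ₜ c)) = a ⊗ₜ (b * t c) := by
  simp [mulTrd]

theorem eq_sum_smulRight [FiniteDimensional k H] (t : Module.End k H) :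
    t = ∑ i, ((Module.finBasis k H).coord i).smulRight (t (Module.finBasis k H i)) := by
  refine LinearMap.ext fun x => ?_
  conv_lhs => rw [← (Module.finBasis k H).sum_repr x, map_sum]
  simp

theorem mulTrd_comp_coaction_mem [FiniteDimensional k H] (t : Module.End k H) :
    mulTrd t ∘ₗ Q.coaction ∈ LinearMap.range Q.act := by
  -- For `t` of rank one the operator is evaluation of `ρ` at `φ` followed by right multiplication
  -- by `1 ⊗ b`; finite dimension reduces every `t` to a sum of these.
  have h1 : ∀ (φ : Module.Dual k H) (b : H),
      mulTrd (φ.smulRight b) ∘ₗ Q.coaction ∈ LinearMap.range Q.act := by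
    intro φ b
    have : mulTrd (φ.smulRight b) ∘ₗ Q.coaction =
        Q.actRight (Q.S b) * Q.actDualWith φ 1 := by
      refine LinearMap.ext fun m => ?_
      rw [Module.End.mul_apply, actRight_apply, actDualWith_apply, sinv_S, LinearMap.comp_apply,
        ← Algebra.TensorProduct.one_def, mul_one]
      induction Q.coaction m using induction_three with
      | zero => simp
      | add x y hx hy => simp only [add_mul, map_add, hx, hy]
      | tmul x y z => simp
    rw [this]
    exact Q.mul_mem_range_act (Q.actRight_mem_range_act _)
      (Q.mem_admissible.1 Q.one_mem_admissible _)
  have h2 : mulTrd t ∘ₗ Q.coaction = ∑ i, mulTrd (((Module.finBasis k H).coord i).smulRight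
      (t (Module.finBasis k H i))) ∘ₗ Q.coaction := by
    refine LinearMap.ext fun m => ?_
    rw [LinearMap.sum_apply]
    simp only [LinearMap.comp_apply]
    generalize Q.coaction m = w
    induction w using induction_three with
    | zero => simp
    | add x y hx hy => simp only [map_add, hx, hy, Finset.sum_add_distrib]
    | tmul x y z =>
      conv_lhs => rw [eq_sum_smulRight t]
      simp [Finset.mul_sum, tmul_sum]
  rw [h2]
  exact Submodule.sum_mem _ fun i _ => h1 _ _

/-- `a ⊗ b ⊗ c ↦ a β S(b) r f(c)` -/
def projThree (r : H) (f : Module.End k H) : H ⊗[k] (H ⊗[k] H) →ₗ[k] H :=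
  LinearMap.mul' k H ∘ₗ TensorProduct.map Q.coevS (LinearMap.mulLeft k r ∘ₗ f) ∘ₗ
    (TensorProduct.assoc k H H H).symm.toLinearMap

theorem projThree_tmul (r : H) (f : Module.End k H) (a b c : H) :
    Q.projThree r f (a ⊗ₜ (b ⊗ₜ c)) = a * Q.beta * Q.S b * (r * f c) := rfl

theorem projThree_assoc (r : H) (f : Module.End k H) (d : H ⊗[k] H) (c : H) :
    Q.projThree r f (TensorProduct.assoc k H H H (d ⊗ₜ c)) = Q.coevS d * (r * f c) := by
  simp [projThree]

theorem projThree_mul_tmul (r : H) (f : Module.End k H) (a b : H) (w : H ⊗[k] H) :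
    Q.projThree r f ((a * b) ⊗ₜ w) = a * Q.projThree r f (b ⊗ₜ w) := by
  induction w with
  | zero => simp
  | add x y hx hy => simp only [tmul_add, map_add, mul_add, hx, hy]
  | tmul x y => simp [projThree_tmul, mul_assoc]

theorem lTensor_projThree_assoc (r : H) (f : Module.End k H) (D : H ⊗[k] H) (p q : H)
    (w : H ⊗[k] H) :
    LinearMap.lTensor H (Q.projThree r f)
      (TensorProduct.assoc k H H (H ⊗[k] H) ((D * (p ⊗ₜ q)) ⊗ₜ w)) =
      D * (p ⊗ₜ Q.projThree r f (q ⊗ₜ w)) := by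
  induction D with
  | zero => simp
  | add x y hx hy => simp only [add_mul, add_tmul, map_add, hx, hy]
  | tmul x y => simp [projThree_mul_tmul]

/-- For pure tensors everything that happens to the third leg of `ρ(m)` is a linear endomorphism `t`
of `H`, so the operator is `mulTrd t ∘ ρ` followed by left multiplication by some `Δ(a)`. -/
theorem lTensor_projThree_mem [FiniteDimensional k H] (r : H) (f : Module.End k H)
    (z U : H ⊗[k] (H ⊗[k] H)) :
    LinearMap.lTensor H (Q.projThree r f) ∘ₗ LinearMap.mulLeft k (Q.comulFst z) ∘ₗ
      LinearMap.mulRight k (1 ⊗ₜ U) ∘ₗ Q.comulTrd.toLinearMap ∘ₗ Q.coaction ∈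
      LinearMap.range Q.act := by
  induction z using induction_three with
  | zero => simp
  | add x y hx hy =>
    convert add_mem hx hy using 1
    refine LinearMap.ext fun m => ?_
    simp [add_mul]
  | tmul a b c =>
    induction U using induction_three with
    | zero => simp
    | add x y hx hy =>
      convert add_mem hx hy using 1
      refine LinearMap.ext fun m => ?_
      simp [mul_add, tmul_add]
    | tmul u v w =>
      have : LinearMap.lTensor H (Q.projThree r f) ∘ₗ
          LinearMap.mulLeft k (Q.comulFst (a ⊗ₜ (b ⊗ₜ c))) ∘ₗ
          LinearMap.mulRight k (1 ⊗ₜ (u ⊗ₜ (v ⊗ₜ w))) ∘ₗ Q.comulTrd.toLinearMap ∘ₗ Q.coaction =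
          Q.actLeft a * (mulTrd (Q.projThree r f ∘ₗ TensorProduct.mk k H (H ⊗[k] H) u ∘ₗ
            LinearMap.mulLeft k (b ⊗ₜ c) ∘ₗ LinearMap.mulRight k (v ⊗ₜ w) ∘ₗ
            Q.comul.toLinearMap) ∘ₗ Q.coaction) := by
        refine LinearMap.ext fun m => ?_
        rw [Module.End.mul_apply, actLeft_apply]
        change LinearMap.lTensor H (Q.projThree r f) (Q.comulFst (a ⊗ₜ (b ⊗ₜ c)) *
          (Q.comulTrd (Q.coaction m) * (1 ⊗ₜ (u ⊗ₜ (v ⊗ₜ w))))) =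
          Q.comul a * mulTrd _ (Q.coaction m)
        generalize Q.coaction m = n
        induction n using induction_three with
        | zero => simp
        | add x y hx hy => simp only [add_mul, mul_add, map_add, hx, hy]
        | tmul x y z =>
          rw [comulTrd_tmul, comulRight_tmul, Algebra.TensorProduct.tmul_mul_tmul,
            Algebra.TensorProduct.tmul_mul_tmul, comulFst_tmul, assoc_mul_tmul_tmul,
            lTensor_projThree_assoc, projThree_mul_tmul, mulTrd_tmul, mul_one]
          rfl
      rw [this]
      exact Q.mul_mem_range_act (Q.actLeft_mem_range_act a) (Q.mulTrd_comp_coaction_mem _)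

theorem comulTrd_comulRight_mul (m : H ⊗[k] H) :
    Q.comulTrd (Q.comulRight m) * (1 ⊗ₜ (Q.reassoc : H ⊗[k] (H ⊗[k] H))) =
      (1 ⊗ₜ (Q.reassoc : H ⊗[k] (H ⊗[k] H))) * Q.comulSnd (Q.comulRight m) := by
  induction m with
  | zero => simp
  | add x y hx hy => simp only [add_mul, mul_add, map_add, hx, hy]
  | tmul a b => simp [comulRight_comul_mul_reassoc]

/-- Quasi-coassociativity of `ρ`, obtained from the inverted pentagon. It moves the extra coproduct
from the third leg of `ρ(m)` to the second, where `β` can collapse it. -/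
theorem comulFst_inv_mul_comulTrd_coaction (m : H ⊗[k] H) :
    Q.comulFst Q.reassocInv *
      (Q.comulTrd (Q.coaction m) * (1 ⊗ₜ (Q.reassoc : H ⊗[k] (H ⊗[k] H)))) =
      appendThree k H Q.reassocInv * Q.comulSnd (Q.coaction m) := by
  have e : (1 : H) ⊗ₜ[k] Q.reassocInv * (1 : H) ⊗ₜ[k] (Q.reassoc : H ⊗[k] (H ⊗[k] H)) = 1 := by
    rw [Algebra.TensorProduct.tmul_mul_tmul, reassoc_inv_mul, one_mul]; rfl
  rw [coaction_apply, map_mul, mul_assoc (Q.comulTrd _), comulTrd_comulRight_mul, ← mul_assoc,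
    ← append_comulSnd_inv, mul_assoc, ← mul_assoc ((1 : H) ⊗ₜ[k] Q.reassocInv), e, one_mul,
    mul_assoc, ← map_mul]

/-- `id ⊗ ε ⊗ id : H ⊗ H ⊗ H → H ⊗ H` -/
def counitMid : H ⊗[k] (H ⊗[k] H) →ₐ[k] H ⊗[k] H :=
  Algebra.TensorProduct.map (AlgHom.id k H)
    ((Algebra.TensorProduct.lid k H).toAlgHom.comp
      (Algebra.TensorProduct.map Q.counit (AlgHom.id k H)))

@[simp] theorem counitMid_tmul (a b c : H) :
    Q.counitMid (a ⊗ₜ (b ⊗ₜ c)) = a ⊗ₜ (Q.counit b • c) := rfl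

theorem counitMid_coaction (m : H ⊗[k] H) : Q.counitMid (Q.coaction m) = m := by
  have h1 : Q.counitMid Q.reassocInv = 1 := by
    have := Q.eq_of_counit_snd Q.counit_snd_inv Q.counitMid.toLinearMap (fun a b c => by simp)
    exact this.trans (map_one Q.counitMid)
  have h2 : Q.counitMid (Q.comulRight m) = m := by
    induction m with
    | zero => simp
    | add x y hx hy => simp only [map_add, hx, hy]
    | tmul a b =>
      change a ⊗ₜ[k] (Algebra.TensorProduct.lid k H
        (Algebra.TensorProduct.map Q.counit (AlgHom.id k H) (Q.comul b))) = _
      rw [Q.counit_id_comul]; simp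
  rw [coaction_apply, map_mul, h1, h2, one_mul]

theorem coevS_mul_comul (h : H) (w : H ⊗[k] H) :
    Q.coevS (w * Q.comul h) = Q.counit h • Q.coevS w := by
  induction w with
  | zero => simp
  | add x y hx hy => simp only [add_mul, map_add, hx, hy, smul_add]
  | tmul a b =>
    have : ∀ d, Q.coevS ((a ⊗ₜ b) * d) = a * Q.coevS d * Q.S b := by
      intro d
      induction d with
      | zero => simp
      | add x y hx hy => simp only [add_mul, mul_add, map_add, hx, hy]
      | tmul x y => simp [S_mul, mul_assoc]
    simp [this, coevS_comul]

theorem evS_comul_mul (h : H) (w : H ⊗[k] H) :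
    Q.evS (Q.comul h * w) = Q.counit h • Q.evS w := by
  induction w with
  | zero => simp
  | add x y hx hy => simp only [mul_add, map_add, hx, hy, smul_add]
  | tmul a b =>
    have : ∀ d, Q.evS (d * (a ⊗ₜ b)) = Q.S a * Q.evS d * b := by
      intro d
      induction d with
      | zero => simp
      | add x y hx hy => simp only [add_mul, mul_add, map_add, hx, hy]
      | tmul x y => simp [S_mul, mul_assoc]
    simp [this, evS_comul]

theorem lTensor_projThree_append (r : H) (f : Module.End k H) (u w : H ⊗[k] (H ⊗[k] H)) :
    LinearMap.lTensor H (Q.projThree r f) (appendThree k H u * Q.comulSnd w) =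
      LinearMap.lTensor H Q.coevS u * (1 ⊗ₜ r) * LinearMap.lTensor H f (Q.counitMid w) := by
  induction u using induction_three with
  | zero => simp
  | add x y hx hy => simp only [add_mul, map_add, hx, hy]
  | tmul x y z =>
    induction w using induction_three with
    | zero => simp
    | add x y hx hy => simp only [mul_add, map_add, hx, hy]
    | tmul a b c =>
      rw [comulSnd_tmul, appendThree_tmul, appendTwo_tmul, comulLeft_tmul,
        Algebra.TensorProduct.tmul_mul_tmul, tmul_mul_assoc, LinearMap.lTensor_tmul,
        projThree_assoc, coevS_mul_comul]
      simp [mul_assoc]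

theorem comulFst_tmul_one (a b : H) :
    Q.comulFst (a ⊗ₜ (b ⊗ₜ 1)) = appendThree k H (Q.comulLeft (a ⊗ₜ b)) := by
  rw [comulFst_tmul, comulLeft_tmul]
  induction Q.comul a with
  | zero => simp
  | add x y hx hy => simp only [add_tmul, map_add, hx, hy]
  | tmul x y => simp

theorem comulFst_one_tmul (c : H) :
    Q.comulFst (1 ⊗ₜ (1 ⊗ₜ c)) = 1 ⊗ₜ (1 ⊗ₜ (1 ⊗ₜ c)) := by
  rw [comulFst_tmul, map_one, Algebra.TensorProduct.one_def]; simp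

theorem lTensor_zigzagS_comulFst_mul (a b c : H) :
    LinearMap.lTensor H Q.zigzagS
      (Q.comulFst (a ⊗ₜ (b ⊗ₜ c)) * appendThree k H Q.reassocInv) =
      LinearMap.lTensor H Q.coevS (Q.comulLeft (a ⊗ₜ b) * Q.reassocInv) *
        (1 ⊗ₜ (Q.alpha * c)) := by
  have e : a ⊗ₜ[k] (b ⊗ₜ[k] c) = (1 ⊗ₜ (1 ⊗ₜ c)) * (a ⊗ₜ (b ⊗ₜ 1)) := by simp
  rw [e, map_mul Q.comulFst, comulFst_tmul_one, comulFst_one_tmul, mul_assoc,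
    ← map_mul (appendThree k H)]
  generalize Q.comulLeft (a ⊗ₜ b) * Q.reassocInv = u
  induction u using induction_three with
  | zero => simp
  | add x y hx hy => simp only [add_mul, mul_add, map_add, hx, hy]
  | tmul x y z => simp [mul_assoc]

theorem zigzagS_assoc (d : H ⊗[k] H) (c : H) :
    Q.zigzagS (TensorProduct.assoc k H H H (d ⊗ₜ c)) = Q.coevS d * (Q.alpha * c) := by
  induction d with
  | zero => simp
  | add x y hx hy => simp only [add_tmul, add_mul, map_add, hx, hy]
  | tmul x y => simp [mul_assoc]

theorem lTensor_zigzagS_comulTrd_mul (y : H ⊗[k] (H ⊗[k] (H ⊗[k] H))) :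
    LinearMap.lTensor H Q.zigzagS (Q.comulTrd Q.reassocInv * y) =
      LinearMap.lTensor H Q.zigzagS y := by
  have := Q.eq_of_counit_trd Q.counit_trd_inv
    (LinearMap.lTensor H Q.zigzagS ∘ₗ LinearMap.mulRight k y ∘ₗ Q.comulTrd.toLinearMap)
    (fun a b c => by
      change LinearMap.lTensor H Q.zigzagS (Q.comulTrd (a ⊗ₜ (b ⊗ₜ c)) * y) =
        Q.counit c • LinearMap.lTensor H Q.zigzagS (Q.comulTrd (a ⊗ₜ (b ⊗ₜ 1)) * y)
      induction y using induction_four with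
      | zero => simp
      | add x y hx hy => simp only [mul_add, map_add, hx, hy, smul_add]
      | tmul p q r s => simp [evS_comul_mul])
  refine this.trans ?_
  change LinearMap.lTensor H Q.zigzagS (Q.comulTrd 1 * y) = _
  rw [map_one, one_mul]

theorem lTensor_zigzagS_mul_comulSnd (y : H ⊗[k] (H ⊗[k] (H ⊗[k] H))) :
    LinearMap.lTensor H Q.zigzagS (y * Q.comulSnd Q.reassoc) =
      LinearMap.lTensor H Q.zigzagS y := by
  have := Q.eq_of_counit_snd Q.counit_snd
    (LinearMap.lTensor H Q.zigzagS ∘ₗ LinearMap.mulLeft k y ∘ₗ Q.comulSnd.toLinearMap)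
    (fun a b c => by
      change LinearMap.lTensor H Q.zigzagS (y * Q.comulSnd (a ⊗ₜ (b ⊗ₜ c))) =
        Q.counit b • LinearMap.lTensor H Q.zigzagS (y * Q.comulSnd (a ⊗ₜ (1 ⊗ₜ c)))
      induction y using induction_four with
      | zero => simp
      | add x y hx hy => simp only [add_mul, map_add, hx, hy, smul_add]
      | tmul p q r s =>
        rw [comulSnd_tmul, comulSnd_tmul, comulLeft_tmul, comulLeft_tmul,
          Algebra.TensorProduct.tmul_mul_tmul, Algebra.TensorProduct.tmul_mul_tmul,
          tmul_mul_assoc, tmul_mul_assoc, LinearMap.lTensor_tmul, LinearMap.lTensor_tmul,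
          zigzagS_assoc, zigzagS_assoc, coevS_mul_comul, coevS_mul_comul]
        simp)
  refine this.trans ?_
  change LinearMap.lTensor H Q.zigzagS (y * Q.comulSnd 1) = _
  rw [map_one, mul_one]

/-- In the pentagon solved for this product, the outer factors meet `α` or `β` through a coproduct
and are erased by counits; the middle factor `1 ⊗ Φ` gives `X¹ β S(X²) α X³ = 1`. -/
theorem lTensor_zigzagS_eq_one :
    LinearMap.lTensor H Q.zigzagS
      (Q.comulFst Q.reassoc * appendThree k H Q.reassocInv) = 1 := by
  rw [comulFst_mul_append_inv, lTensor_zigzagS_mul_comulSnd, lTensor_zigzagS_comulTrd_mul,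
    LinearMap.lTensor_tmul, zigzagS_reassoc]
  rfl

/-- Collapsing `(id ⊗ Δ ⊗ id)(ρ(m))` with `β` leaves `(id ⊗ ε ⊗ id)(ρ(m)) = m`, on whose second leg
`f` then acts. The surplus left factor becomes `1` after summation over the legs of `Φ`. -/
theorem lTensor_mem_range_act [FiniteDimensional k H] (f : Module.End k H) :
    LinearMap.lTensor H f ∈ LinearMap.range Q.act := by
  have h : ∀ z, LinearMap.mulLeft k (LinearMap.lTensor H Q.zigzagS
      (Q.comulFst z * appendThree k H Q.reassocInv)) ∘ₗ LinearMap.lTensor H f ∈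
      LinearMap.range Q.act := by
    intro z
    induction z using induction_three with
    | zero => simp
    | add x y hx hy =>
      convert add_mem hx hy using 1
      refine LinearMap.ext fun m => ?_
      simp [add_mul]
    | tmul a b c =>
      -- The leg `c` must multiply the value of `f` and not its argument, so it is placed in `r = α
      -- c` while the third leg of `z` receives `1`. The factors `Φ⁻¹` and `Φ` are those required by
      -- the quasi-coassociativity of `ρ`.
      convert Q.lTensor_projThree_mem (Q.alpha * c) f ((a ⊗ₜ (b ⊗ₜ 1)) * Q.reassocInv)
        Q.reassoc using 1
      refine LinearMap.ext fun m => ?_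
      change LinearMap.lTensor H Q.zigzagS
        (Q.comulFst (a ⊗ₜ (b ⊗ₜ c)) * appendThree k H Q.reassocInv) * LinearMap.lTensor H f m =
        LinearMap.lTensor H (Q.projThree (Q.alpha * c) f)
          (Q.comulFst ((a ⊗ₜ (b ⊗ₜ 1)) * Q.reassocInv) *
            (Q.comulTrd (Q.coaction m) * (1 ⊗ₜ (Q.reassoc : H ⊗[k] (H ⊗[k] H)))))
      rw [map_mul Q.comulFst, mul_assoc (Q.comulFst _), comulFst_inv_mul_comulTrd_coaction,
        comulFst_tmul_one, ← mul_assoc, ← map_mul (appendThree k H), lTensor_projThree_append, counitMid_coaction, lTensor_zigzagS_comulFst_mul]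
  have := h Q.reassoc
  rw [lTensor_zigzagS_eq_one] at this
  convert this using 1
  refine LinearMap.ext fun m => ?_
  simp

/-- Left multiplication by `a` on the first leg alone is not among the generators, but `Δ(a)` is.
Resetting the second leg to `1` beforehand and applying `ε` to it afterwards leaves exactly `a` on
the first leg. -/
theorem map_mulLeft_smulRight_mem [FiniteDimensional k H] (a y : H) (ξ : Module.Dual k H) :
    TensorProduct.map (LinearMap.mulLeft k a) (ξ.smulRight y) ∈ LinearMap.range Q.act := by
  have : TensorProduct.map (LinearMap.mulLeft k a) (ξ.smulRight y) =
      LinearMap.lTensor H (Q.counit.toLinearMap.smulRight y) * (Q.actLeft a *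
        LinearMap.lTensor H (ξ.smulRight 1)) := by
    have h : ∀ (D : H ⊗[k] H) (v : H), LinearMap.lTensor H (Q.counit.toLinearMap.smulRight y)
        (D * (v ⊗ₜ 1)) = (Q.counitRight D * v) ⊗ₜ y := by
      intro D v
      induction D with
      | zero => simp
      | add x y hx hy => simp only [add_mul, add_tmul, map_add, hx, hy]
      | tmul x y => simp [smul_tmul']
    refine TensorProduct.ext' fun v x => ?_
    rw [Module.End.mul_apply, Module.End.mul_apply, actLeft_apply]
    simp [h, counitRight_comul]
  rw [this]
  exact Q.mul_mem_range_act (Q.lTensor_mem_range_act _)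
    (Q.mul_mem_range_act (Q.actLeft_mem_range_act _) (Q.lTensor_mem_range_act _))

/-! ### The copy of `End(H) ⊗ H` and the dimension count. -/

variable (k H) in
/-- `f ⊗ a ↦ (v ⊗ x ↦ a v ⊗ f(x))` -/
def endMap : Module.End k H ⊗[k] H →ₗ[k] Module.End k (H ⊗[k] H) :=
  TensorProduct.homTensorHomMap (.id k) H H H H ∘ₗ
    LinearMap.rTensor (Module.End k H) (LinearMap.mul k H) ∘ₗ
    (TensorProduct.comm k (Module.End k H) H).toLinearMap

theorem endMap_tmul (f : Module.End k H) (a : H) :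
    endMap k H (f ⊗ₜ a) = TensorProduct.map (LinearMap.mulLeft k a) f := rfl

theorem endMap_one : endMap k H 1 = 1 := by
  rw [Algebra.TensorProduct.one_def, endMap_tmul]
  ext; simp

theorem endMap_mul (x y : Module.End k H ⊗[k] H) :
    endMap k H (x * y) = endMap k H x * endMap k H y := by
  induction x with
  | zero => simp
  | add x y hx hy => simp only [add_mul, map_add, hx, hy]
  | tmul f a =>
    induction y with
    | zero => simp
    | add x y hx hy => simp only [mul_add, map_add, hx, hy]
    | tmul g b =>
      rw [Algebra.TensorProduct.tmul_mul_tmul, endMap_tmul, endMap_tmul, endMap_tmul]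
      refine TensorProduct.ext' fun v x => ?_
      rw [Module.End.mul_apply]
      simp

theorem endMap_injective [FiniteDimensional k H] : Function.Injective (endMap k H) := by
  have h1 : Function.Injective (TensorProduct.homTensorHomMap (.id k) H H H H) := by
    rw [← homTensorHomEquiv_toLinearMap]
    exact (homTensorHomEquiv k H H H H).injective
  have h2 : Function.Injective (LinearMap.mul k H) := fun a b hab => by
    simpa using LinearMap.congr_fun hab 1
  exact h1.comp ((Module.Flat.rTensor_preserves_injective_linearMap _ h2).comp
    (TensorProduct.comm k (Module.End k H) H).injective)

theorem range_endMap_le [FiniteDimensional k H] :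
    LinearMap.range (endMap k H) ≤ LinearMap.range Q.act := by
  rintro _ ⟨x, rfl⟩
  induction x with
  | zero => simp
  | add x y hx hy => rw [map_add]; exact add_mem hx hy
  | tmul f a =>
    rw [eq_sum_smulRight f, sum_tmul, map_sum]
    exact Submodule.sum_mem _ fun i _ => Q.map_mulLeft_smulRight_mem _ _ _

theorem finrank_crossed_eq [FiniteDimensional k H] :
    Module.finrank k (H ⊗[k] (Module.Dual k H ⊗[k] H)) =
      Module.finrank k (Module.End k H ⊗[k] H) := by
  have h : Module.finrank k (Module.End k H) = Module.finrank k H * Module.finrank k H :=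
    Module.finrank_linearMap k k H H
  simp only [Module.finrank_tensorProduct, Subspace.dual_finrank_eq, h]
  ring

/-- The image of `act` contains that of the injective `endMap`, and its dimension is at most that of
the crossed product, which equals that of `End(H) ⊗ H`. -/
theorem range_endMap_eq [FiniteDimensional k H] :
    LinearMap.range (endMap k H) = LinearMap.range Q.act := by
  refine Submodule.eq_of_le_of_finrank_le Q.range_endMap_le ?_
  rw [LinearMap.finrank_range_of_inj endMap_injective, ← finrank_crossed_eq]
  exact LinearMap.finrank_range_le _

theorem act_injective [FiniteDimensional k H] : Function.Injective Q.act := by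
  have h := LinearMap.finrank_range_add_finrank_ker Q.act
  rw [← range_endMap_eq, LinearMap.finrank_range_of_inj endMap_injective, finrank_crossed_eq] at h
  rw [← LinearMap.ker_eq_bot, ← Submodule.finrank_eq_zero (R := k)]
  omega

end QuasiHopfAlgebra

open QuasiHopfAlgebra in
theorem mainTheorem4 {k H : Type*} [Field k] [Ring H] [Algebra k H] [FiniteDimensional k H]
    (Q : QuasiHopfAlgebra k H) :
    (∀ x y z : H ⊗[k] (Module.Dual k H ⊗[k] H),
      Q.crossedMul (Q.crossedMul x y) z = Q.crossedMul x (Q.crossedMul y z)) ∧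
    (∀ x : H ⊗[k] (Module.Dual k H ⊗[k] H),
      Q.crossedMul Q.crossedOne x = x ∧ Q.crossedMul x Q.crossedOne = x) ∧
    ∃ e : (H ⊗[k] (Module.Dual k H ⊗[k] H)) ≃ₗ[k] (Module.End k H ⊗[k] H),
      e Q.crossedOne = 1 ∧
      ∀ x y : H ⊗[k] (Module.Dual k H ⊗[k] H), e (Q.crossedMul x y) = e x * e y := by
  -- Injectivity is available before associativity is known, since `act` is multiplicative for the
  -- bare bilinear product; the algebra laws are then inherited from the endomorphism algebra.
  have hinj := Q.act_injective
  refine ⟨fun x y z => hinj ?_, fun x => ⟨hinj ?_, hinj ?_⟩, ?_⟩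
  · simp only [act_crossedMul, mul_assoc]
  · rw [act_crossedMul, act_crossedOne, one_mul]
  · rw [act_crossedMul, act_crossedOne, mul_one]
  let e : (H ⊗[k] (Module.Dual k H ⊗[k] H)) ≃ₗ[k] (Module.End k H ⊗[k] H) :=
    (LinearEquiv.ofInjective Q.act hinj).trans
      ((LinearEquiv.ofEq _ _ Q.range_endMap_eq.symm).trans
        (LinearEquiv.ofInjective (endMap k H) endMap_injective).symm)
  have he : ∀ x, endMap k H (e x) = Q.act x := fun x =>
    congrArg Subtype.val ((LinearEquiv.ofInjective (endMap k H)
      endMap_injective).apply_symm_apply (LinearEquiv.ofEq _ _ Q.range_endMap_eq.symm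
        (LinearEquiv.ofInjective Q.act hinj x)))
  refine ⟨e, endMap_injective ?_, fun x y => endMap_injective ?_⟩
  · rw [he, act_crossedOne, endMap_one]
  · rw [he, endMap_mul, he, he, act_crossedMul]
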